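/- All $C^*$-algebras are complex and not necessarily unital. For a $C^*$-algebra $A$ let $\widetilde A$ be its unitization (a new unit is adjoined even if $A$ is unital). Let $\mathcal M(\widetilde A)=\bigcup_n M_n(\widetilde A)$, where $M_n(\widetilde A)\subseteq M_{n+1}(\widetilde A)$ is the upper left corner inclusion. A *projection* is a self-adjoint idempotent. If $p,q\in\mathcal M(\widetilde A)$ are projections, an *invertible morphism* from $p$ to $q$ over $\widetilde A$ is an element $a\in q\mathcal M(\widetilde A)p$ for which there is $b\in p\mathcal M(\widetilde A)q$ with $ab=q$ and $ba=p$. Let $A'\subseteq A$ be a $C^*$-subalgebra, and regard $\widetilde{A'}\subseteq\widetilde A$ unitally. Let $\Gamma(A';A)$ be the set of triples $(p,q,a)$ where $p,q$ are projections in $\mathcal M(\widetilde{A'})$ and $a$ is an invertible morphism from $p$ to $q$ over $\widetilde A$. * Triples $(p,q,a)$ and $(p',q',a')$ are *isomorphic* if there are invertible morphisms $c$ from $p$ to $p'$ and $d$ from $q$ to $q'$ over $\widetilde{A'}$ with $da=a'c$. * A triple $(p,q,a)$ is *elementary* if $p=q$ and there is a norm-continuous path from $p$ to $a$ in the group of invertible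 elements of $p\mathcal M(\widetilde A)p$. * $(p,q,a)\oplus(p',q',a')=(p\oplus p',q\oplus q',a\oplus a')$ is the block diagonal sum (well defined up to isomorphism). * $x\sim y$ if there are elementary triples $e,f$ such that $x\oplus e$ is isomorphic to $y\oplus f$. *Karoubi's relative group* $K_0(A';A)$ is the set of $\sim$-classes $[p,q,a]$; with $[p,q,a]+[p',q',a']=[p\oplus p',q\oplus q',a\oplus a']$ it is an abelian group with neutral element $[0,0,0]$. If $\pi:A\to B$ is a $*$-homomorphism of $C^*$-algebras and $A'\subseteq A$, $B'\subseteq B$ are $C^*$-subalgebras with $\pi(A')\subseteq B'$, applying the unital extension $\widetilde A\to\widetilde B$ of $\pi$ to matrix entries defines a group homomorphism $\pi_*:K_0(A';A)\to K_0(B';B)$, $[p,q,a]\mapsto[\pi(p),\pi(q),\pi(a)]$. **Theorem 2.70.** Let $A,C,D$ be $C^*$-algebras, let $A'\subseteq A$ and $C'\subseteq C$ be $C^*$-subalgebras, and let $\pi:A\to C$ and $\rho:C\to D$ be $*$-homomorphisms such that $\pi(A')\subseteq C'$ and both rows $$0\to A\xrightarrow{\ \pi\ }C\xrightarrow{\ \rho\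 }D\to0,\qquad 0\to A'\xrightarrow{\ \pi|_{A'}\ }C'\xrightarrow{\ \rho|_{C'}\ }D\to0$$ are exact. Then $\pi_*:K_0(A';A)\to K_0(C';C)$ is an isomorphism of groups. -/

import Mathlib

/-!
# Karoubi's relative group `K₀(A'; A)` of a C⋆-algebra and a C⋆-subalgebra

For a ring `R`, the elements of `𝓜(R) = ⋃ₙ Mₙ(R)` are represented by square matrices of a finite
size, padded by zeros when the size has to grow.  If `p ∈ M_m(R)` and `q ∈ M_n(R)` are idempotents,
then every element of `q 𝓜(R) p` is supported in the upper left `n × m` corner, so that the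
morphisms from `p` to `q` are exactly the `n × m` matrices `a` with `q a = a = a p`.
-/

namespace KaroubiRel

universe u v u' v'

section Morphisms

variable {R : Type u} [Ring R] {ι κ μ ν : Type} [Fintype ι] [Fintype κ] [Fintype μ] [Fintype ν]

/-- `a` is a morphism from the idempotent `p` to the idempotent `q`, i.e. `a ∈ q 𝓜(R) p`. -/
def IsMor (p : Matrix ι ι R) (q : Matrix κ κ R) (a : Matrix κ ι R) : Prop :=
  q * a = a ∧ a * p = a

/-- `a` is an invertible morphism from `p` to `q`: there is a morphism `b` from `q` to `p`
with `a b = q` and `b a = p`. -/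
def IsInvMor (p : Matrix ι ι R) (q : Matrix κ κ R) (a : Matrix κ ι R) : Prop :=
  IsMor p q a ∧ ∃ b : Matrix ι κ R, IsMor q p b ∧ a * b = q ∧ b * a = p

theorem IsInvMor.refl {p : Matrix ι ι R} (hp : p * p = p) : IsInvMor p p p :=
  ⟨⟨hp, hp⟩, p, ⟨hp, hp⟩, hp, hp⟩

theorem IsInvMor.comp {p : Matrix ι ι R} {q : Matrix κ κ R} {r : Matrix μ μ R}
    {a : Matrix κ ι R} {c : Matrix μ κ R} (ha : IsInvMor p q a) (hc : IsInvMor q r c) :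
    IsInvMor p r (c * a) := by
  obtain ⟨⟨h1, h2⟩, b, ⟨h3, h4⟩, h5, h6⟩ := ha
  obtain ⟨⟨k1, k2⟩, d, ⟨k3, k4⟩, k5, k6⟩ := hc
  refine ⟨⟨by rw [← Matrix.mul_assoc, k1], by rw [Matrix.mul_assoc, h2]⟩, b * d,
    ⟨by rw [← Matrix.mul_assoc, h3], by rw [Matrix.mul_assoc, k4]⟩, ?_, ?_⟩
  · rw [Matrix.mul_assoc, ← Matrix.mul_assoc a, h5, k3, k5]
  · rw [Matrix.mul_assoc, ← Matrix.mul_assoc d, k6, h1, h6]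

theorem IsInvMor.map {S : Type v} [Ring S] (f : R →+* S) {p : Matrix ι ι R} {q : Matrix κ κ R}
    {a : Matrix κ ι R} (ha : IsInvMor p q a) : IsInvMor (p.map f) (q.map f) (a.map f) := by
  obtain ⟨⟨h1, h2⟩, b, ⟨h3, h4⟩, h5, h6⟩ := ha
  refine ⟨⟨?_, ?_⟩, b.map f, ⟨?_, ?_⟩, ?_, ?_⟩ <;> rw [← Matrix.map_mul] <;> simp only [*]

theorem IsInvMor.fromBlocks {p : Matrix ι ι R} {q : Matrix κ κ R} {a : Matrix κ ι R}
    {r : Matrix μ μ R} {s : Matrix ν ν R} {c : Matrix ν μ R}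
    (ha : IsInvMor p q a) (hc : IsInvMor r s c) :
    IsInvMor (Matrix.fromBlocks p 0 0 r) (Matrix.fromBlocks q 0 0 s)
      (Matrix.fromBlocks a 0 0 c) := by
  obtain ⟨⟨h1, h2⟩, b, ⟨h3, h4⟩, h5, h6⟩ := ha
  obtain ⟨⟨k1, k2⟩, d, ⟨k3, k4⟩, k5, k6⟩ := hc
  refine ⟨⟨?_, ?_⟩, Matrix.fromBlocks b 0 0 d, ⟨?_, ?_⟩, ?_, ?_⟩ <;>
    simp [Matrix.fromBlocks_multiply, *]

theorem IsInvMor.reindex (e : ι ≃ κ) {p q a : Matrix ι ι R} (ha : IsInvMor p q a) :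
    IsInvMor (Matrix.reindex e e p) (Matrix.reindex e e q) (Matrix.reindex e e a) := by
  obtain ⟨⟨h1, h2⟩, b, ⟨h3, h4⟩, h5, h6⟩ := ha
  refine ⟨⟨?_, ?_⟩, Matrix.reindex e e b, ⟨?_, ?_⟩, ?_, ?_⟩ <;>
    simp only [Matrix.reindex_apply, Matrix.submatrix_mul_equiv, *]

theorem IsInvMor.of_reindex (e : ι ≃ κ) {p : Matrix ι ι R} (hp : p * p = p) :
    IsInvMor p (Matrix.reindex e e p) (p.submatrix e.symm id) := by
  have key : p.submatrix e.symm id * p.submatrix id e.symm = Matrix.reindex e e p := by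
    have := Matrix.submatrix_mul_equiv p p e.symm (Equiv.refl ι) e.symm
    rw [hp] at this
    exact this
  refine ⟨⟨?_, ?_⟩, p.submatrix id e.symm, ⟨?_, ?_⟩, key, ?_⟩
  · have := Matrix.submatrix_mul_equiv p p e.symm e.symm id
    rw [hp] at this
    exact this
  · have := Matrix.submatrix_mul_equiv p p e.symm (Equiv.refl ι) id
    rw [hp] at this
    exact this
  · have := Matrix.submatrix_mul_equiv p p id (Equiv.refl ι) e.symm
    rw [hp] at this
    exact this
  · have := Matrix.submatrix_mul_equiv p p id e.symm e.symm
    rw [hp] at this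
    exact this
  · have := Matrix.submatrix_mul_equiv p p id e.symm id
    rw [hp] at this
    exact this

end Morphisms

section Triples

variable {R : Type u} {S : Type v} [Ring R] [StarRing R] [Algebra ℂ R] [CStarAlgebra S]

/-- A triple `(p, q, a)` for a unital `*`-homomorphism `φ : R → S`: projections `p`, `q` in
matrices over `R` and an invertible morphism `a` from `φ(p)` to `φ(q)` in matrices over `S`.
Rows and columns are indexed by a finite type `ι`. -/
@[ext]
structure Triple (φ : R →⋆ₐ[ℂ] S) (ι : Type) [Fintype ι] where
  p : Matrix ι ι R
  q : Matrix ι ι R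
  a : Matrix ι ι S
  isStarProjection_p : IsStarProjection p
  isStarProjection_q : IsStarProjection q
  isInvMor_a : IsInvMor (p.map φ) (q.map φ) a

namespace Triple

variable {φ : R →⋆ₐ[ℂ] S} {ι κ μ ν : Type} [Fintype ι] [Fintype κ] [Fintype μ] [Fintype ν]

theorem hp (x : Triple φ ι) : x.p * x.p = x.p := x.isStarProjection_p.isIdempotentElem

theorem hq (x : Triple φ ι) : x.q * x.q = x.q := x.isStarProjection_q.isIdempotentElem

/-- Two triples `(p, q, a)` and `(p', q', a')` are isomorphic if there are invertible morphisms
`c` from `p` to `p'` and `d` from `q` to `q'`, both over `R`, such that `d a = a' c`. -/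
def Iso (x : Triple φ ι) (y : Triple φ κ) : Prop :=
  ∃ (c : Matrix κ ι R) (d : Matrix κ ι R),
    IsInvMor x.p y.p c ∧ IsInvMor x.q y.q d ∧ d.map φ * x.a = y.a * c.map φ

/-- A triple `(p, q, a)` is elementary if `p = q` and `a` is homotopic to `p` among the
automorphisms of `p`, i.e. there is a norm continuous path from `p` to `a` in the group of
invertible elements of `p Mₙ(S) p`.  (On matrices of a fixed size the C⋆-norm topology is the
topology of entrywise convergence.) -/
def Elementary (x : Triple φ ι) : Prop :=
  x.p = x.q ∧ JoinedIn {w : Matrix ι ι S | IsInvMor (x.p.map φ) (x.p.map φ) w} (x.p.map φ) x.a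

/-- The block diagonal sum of two triples. -/
def sum (x : Triple φ ι) (y : Triple φ κ) : Triple φ (ι ⊕ κ) where
  p := Matrix.fromBlocks x.p 0 0 y.p
  q := Matrix.fromBlocks x.q 0 0 y.q
  a := Matrix.fromBlocks x.a 0 0 y.a
  isStarProjection_p := by
    refine ⟨?_, ?_⟩
    · simp [IsIdempotentElem, Matrix.fromBlocks_multiply, hp]
    · have h1 := x.isStarProjection_p.isSelfAdjoint.star_eq
      have h2 := y.isStarProjection_p.isSelfAdjoint.star_eq
      rw [Matrix.star_eq_conjTranspose] at h1 h2
      simp [IsSelfAdjoint, Matrix.star_eq_conjTranspose, Matrix.fromBlocks_conjTranspose, h1, h2]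
  isStarProjection_q := by
    refine ⟨?_, ?_⟩
    · simp [IsIdempotentElem, Matrix.fromBlocks_multiply, hq]
    · have h1 := x.isStarProjection_q.isSelfAdjoint.star_eq
      have h2 := y.isStarProjection_q.isSelfAdjoint.star_eq
      rw [Matrix.star_eq_conjTranspose] at h1 h2
      simp [IsSelfAdjoint, Matrix.star_eq_conjTranspose, Matrix.fromBlocks_conjTranspose, h1, h2]
  isInvMor_a := by
    simpa [Matrix.fromBlocks_map] using x.isInvMor_a.fromBlocks y.isInvMor_a

/-- Renaming the row and column indices of a triple. -/
def reindex (e : ι ≃ κ) (x : Triple φ ι) : Triple φ κ where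
  p := Matrix.reindex e e x.p
  q := Matrix.reindex e e x.q
  a := Matrix.reindex e e x.a
  isStarProjection_p := by
    refine ⟨?_, ?_⟩
    · simp [IsIdempotentElem, Matrix.submatrix_mul_equiv, hp]
    · have h1 := x.isStarProjection_p.isSelfAdjoint.star_eq
      rw [Matrix.star_eq_conjTranspose] at h1
      simp [IsSelfAdjoint, Matrix.star_eq_conjTranspose, Matrix.conjTranspose_submatrix, h1]
  isStarProjection_q := by
    refine ⟨?_, ?_⟩
    · simp [IsIdempotentElem, Matrix.submatrix_mul_equiv, hq]
    · have h1 := x.isStarProjection_q.isSelfAdjoint.star_eq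
      rw [Matrix.star_eq_conjTranspose] at h1
      simp [IsSelfAdjoint, Matrix.star_eq_conjTranspose, Matrix.conjTranspose_submatrix, h1]
  isInvMor_a := x.isInvMor_a.reindex e

/-- The triple `(0, 0, 0)`. -/
def zero (φ : R →⋆ₐ[ℂ] S) (ι : Type) [Fintype ι] : Triple φ ι where
  p := 0
  q := 0
  a := 0
  isStarProjection_p := ⟨by simp [IsIdempotentElem], by simp [IsSelfAdjoint]⟩
  isStarProjection_q := ⟨by simp [IsIdempotentElem], by simp [IsSelfAdjoint]⟩
  isInvMor_a := ⟨⟨by simp, by simp⟩, 0, ⟨by simp, by simp⟩, by simp, by simp⟩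

/-- The triple `(q, p, b)`, where `b` is the inverse of `a`. -/
noncomputable def inv (x : Triple φ ι) : Triple φ ι where
  p := x.q
  q := x.p
  a := x.isInvMor_a.2.choose
  isStarProjection_p := x.isStarProjection_q
  isStarProjection_q := x.isStarProjection_p
  isInvMor_a := by
    have h := x.isInvMor_a.2.choose_spec
    exact ⟨h.1, x.a, x.isInvMor_a.1, h.2.2, h.2.1⟩

theorem a_mul_inv (x : Triple φ ι) : x.a * x.inv.a = x.q.map φ :=
  x.isInvMor_a.2.choose_spec.2.1

theorem inv_mul_a (x : Triple φ ι) : x.inv.a * x.a = x.p.map φ :=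
  x.isInvMor_a.2.choose_spec.2.2

theorem Iso.refl (x : Triple φ ι) : Iso x x := by
  refine ⟨x.p, x.q, .refl x.hp, .refl x.hq, ?_⟩
  rw [x.isInvMor_a.1.1, x.isInvMor_a.1.2]

theorem Iso.trans {x : Triple φ ι} {y : Triple φ κ} {z : Triple φ μ} (h : Iso x y) (k : Iso y z) :
    Iso x z := by
  obtain ⟨c, d, hc, hd, e⟩ := h
  obtain ⟨c', d', hc', hd', e'⟩ := k
  refine ⟨c' * c, d' * d, hc.comp hc', hd.comp hd', ?_⟩
  rw [Matrix.map_mul, Matrix.map_mul, Matrix.mul_assoc, e, ← Matrix.mul_assoc, e',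
    Matrix.mul_assoc]

theorem Iso.symm {x : Triple φ ι} {y : Triple φ κ} (h : Iso x y) : Iso y x := by
  obtain ⟨c, d, ⟨hc, c', hc', e1, e2⟩, ⟨hd, d', hd', e3, e4⟩, e⟩ := h
  refine ⟨c', d', ⟨hc', c, hc, e2, e1⟩, ⟨hd', d, hd, e4, e3⟩, ?_⟩
  have f1 : d'.map φ * d.map φ = x.q.map φ := by rw [← Matrix.map_mul, e4]
  have f2 : c.map φ * c'.map φ = y.p.map φ := by rw [← Matrix.map_mul, e1]
  calc d'.map φ * y.a = d'.map φ * (y.a * (c.map φ * c'.map φ)) := by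
        rw [f2, y.isInvMor_a.1.2]
    _ = d'.map φ * d.map φ * x.a * c'.map φ := by
        rw [← Matrix.mul_assoc y.a, ← e]; simp only [Matrix.mul_assoc]
    _ = x.a * c'.map φ := by rw [f1, x.isInvMor_a.1.1]

theorem Iso.sum {x : Triple φ ι} {y : Triple φ κ} {z : Triple φ μ} {w : Triple φ ν}
    (h : Iso x y) (k : Iso z w) : Iso (x.sum z) (y.sum w) := by
  obtain ⟨c, d, hc, hd, e⟩ := h
  obtain ⟨c', d', hc', hd', e'⟩ := k
  refine ⟨Matrix.fromBlocks c 0 0 c', Matrix.fromBlocks d 0 0 d', hc.fromBlocks hc',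
    hd.fromBlocks hd', ?_⟩
  simp [Triple.sum, Matrix.fromBlocks_map, Matrix.fromBlocks_multiply, e, e']

theorem iso_reindex (e : ι ≃ κ) (x : Triple φ ι) : Iso x (x.reindex e) := by
  refine ⟨_, _, .of_reindex e x.hp, .of_reindex e x.hq, ?_⟩
  have h1 : (x.q.submatrix e.symm id).map φ * x.a = x.a.submatrix e.symm id := by
    have := Matrix.submatrix_mul_equiv (x.q.map φ) x.a e.symm (Equiv.refl ι) id
    rw [x.isInvMor_a.1.1] at this
    exact this
  have h2 : (x.reindex e).a * (x.p.submatrix e.symm id).map φ = x.a.submatrix e.symm id := by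
    have := Matrix.submatrix_mul_equiv x.a (x.p.map φ) e.symm e.symm id
    rw [x.isInvMor_a.1.2] at this
    exact this
  rw [h1, h2]

theorem sum_comm_iso (x : Triple φ ι) (y : Triple φ κ) : Iso (x.sum y) (y.sum x) := by
  have : (x.sum y).reindex (Equiv.sumComm ι κ) = y.sum x := by
    ext i j <;> rcases i with i | i <;> rcases j with j | j <;> rfl
  exact this ▸ iso_reindex (Equiv.sumComm ι κ) (x.sum y)

theorem sum_assoc_iso (x : Triple φ ι) (y : Triple φ κ) (z : Triple φ μ) :
    Iso ((x.sum y).sum z) (x.sum (y.sum z)) := by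
  have : ((x.sum y).sum z).reindex (Equiv.sumAssoc ι κ μ) = x.sum (y.sum z) := by
    ext i j <;> rcases i with i | i | i <;> rcases j with j | j | j <;> rfl
  exact this ▸ iso_reindex (Equiv.sumAssoc ι κ μ) ((x.sum y).sum z)

theorem sum_zero_iso [IsEmpty κ] (x : Triple φ ι) : Iso (x.sum (zero φ κ)) x := by
  have : (x.sum (zero φ κ)).reindex (Equiv.sumEmpty ι κ) = x := by
    ext i j <;> rfl
  have h := iso_reindex (Equiv.sumEmpty ι κ) (x.sum (zero φ κ))
  rwa [this] at h

theorem Elementary.sum {x : Triple φ ι} {y : Triple φ κ} (hx : x.Elementary) (hy : y.Elementary) :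
    (x.sum y).Elementary := by
  obtain ⟨hx1, γ, hγ⟩ := hx
  obtain ⟨hy1, δ, hδ⟩ := hy
  have e : (x.sum y).p.map φ = Matrix.fromBlocks (x.p.map φ) 0 0 (y.p.map φ) := by
    simp [Triple.sum, Matrix.fromBlocks_map]
  refine ⟨by simp [Triple.sum, hx1, hy1], ?_⟩
  rw [e]
  refine ⟨⟨⟨fun t => Matrix.fromBlocks (γ t) 0 0 (δ t), ?_⟩, ?_, ?_⟩, fun t => ?_⟩
  · exact Continuous.matrix_fromBlocks γ.continuous continuous_const continuous_const δ.continuous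
  · simp
  · simp [Triple.sum]
  · exact (hγ t).fromBlocks (hδ t)

theorem Elementary.reindex {x : Triple φ ι} (e : ι ≃ κ) (hx : x.Elementary) :
    (x.reindex e).Elementary := by
  obtain ⟨hx1, γ, hγ⟩ := hx
  refine ⟨by simp [Triple.reindex, hx1], ⟨⟨fun t => Matrix.reindex e e (γ t), ?_⟩, ?_, ?_⟩,
    fun t => ?_⟩
  · exact Continuous.matrix_reindex γ.continuous e e
  · simp [Triple.reindex, Matrix.submatrix_map]
  · simp [Triple.reindex]
  · exact (hγ t).reindex e

theorem zero_elementary : (zero φ ι).Elementary := by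
  refine ⟨rfl, ?_⟩
  have h : (zero φ ι).p.map φ = (zero φ ι).a := by simp [zero]
  rw [h]
  refine JoinedIn.refl ?_
  have := (zero φ ι).isInvMor_a
  simpa [zero] using this

theorem rot_isInvMor (x : Triple φ ι) (c s : ℂ) (h : c * c + s * s = 1) :
    IsInvMor (Matrix.fromBlocks (x.p.map φ) 0 0 (x.q.map φ))
      (Matrix.fromBlocks (x.p.map φ) 0 0 (x.q.map φ))
      (Matrix.fromBlocks (c • x.p.map φ) (s • x.inv.a) (-(s • x.a)) (c • x.q.map φ)) := by
  have hp : x.p.map φ * x.p.map φ = x.p.map φ := by rw [← Matrix.map_mul, x.hp]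
  have hq : x.q.map φ * x.q.map φ = x.q.map φ := by rw [← Matrix.map_mul, x.hq]
  have h1 : x.q.map φ * x.a = x.a := x.isInvMor_a.1.1
  have h2 : x.a * x.p.map φ = x.a := x.isInvMor_a.1.2
  have h3 : x.p.map φ * x.inv.a = x.inv.a := x.inv.isInvMor_a.1.1
  have h4 : x.inv.a * x.q.map φ = x.inv.a := x.inv.isInvMor_a.1.2
  have h5 := x.a_mul_inv
  have h6 := x.inv_mul_a
  have h' : s * s + c * c = 1 := by rw [add_comm, h]
  refine ⟨⟨?_, ?_⟩,
    Matrix.fromBlocks (c • x.p.map φ) (-(s • x.inv.a)) (s • x.a) (c • x.q.map φ),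
    ⟨?_, ?_⟩, ?_, ?_⟩
  · simp [Matrix.fromBlocks_multiply, hp, hq, h1, h3]
  · simp [Matrix.fromBlocks_multiply, hp, hq, h2, h4]
  · simp [Matrix.fromBlocks_multiply, hp, hq, h1, h3]
  · simp [Matrix.fromBlocks_multiply, hp, hq, h2, h4]
  · simp [Matrix.fromBlocks_multiply, hp, hq, h1, h2, h3, h4, h5, h6, smul_smul, ← add_smul,
      h, h', mul_comm c s]
  · simp [Matrix.fromBlocks_multiply, hp, hq, h1, h2, h3, h4, h5, h6, smul_smul, ← add_smul,
      h, h', mul_comm c s]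

/-- The triple `(p ⊕ q, p ⊕ q, u)` where `u` has off-diagonal entries `a⁻¹` and `-a`. -/
noncomputable def rot (x : Triple φ ι) : Triple φ (ι ⊕ ι) where
  p := Matrix.fromBlocks x.p 0 0 x.q
  q := Matrix.fromBlocks x.p 0 0 x.q
  a := Matrix.fromBlocks 0 x.inv.a (-x.a) 0
  isStarProjection_p := (x.sum x.inv).isStarProjection_p
  isStarProjection_q := (x.sum x.inv).isStarProjection_p
  isInvMor_a := by
    simpa [Matrix.fromBlocks_map] using x.rot_isInvMor 0 1 (by simp)

theorem rot_elementary (x : Triple φ ι) : x.rot.Elementary := by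
  have e : x.rot.p.map φ = Matrix.fromBlocks (x.p.map φ) 0 0 (x.q.map φ) := by
    simp [rot, Matrix.fromBlocks_map]
  refine ⟨rfl, ?_⟩
  rw [e]
  refine ⟨⟨⟨fun t => Matrix.fromBlocks (((Real.cos (Real.pi / 2 * t) : ℝ) : ℂ) • x.p.map φ)
    (((Real.sin (Real.pi / 2 * t) : ℝ) : ℂ) • x.inv.a)
    (-(((Real.sin (Real.pi / 2 * t) : ℝ) : ℂ) • x.a))
    (((Real.cos (Real.pi / 2 * t) : ℝ) : ℂ) • x.q.map φ), ?_⟩, ?_, ?_⟩, fun t => ?_⟩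
  · refine Continuous.matrix_fromBlocks ?_ ?_ ?_ ?_ <;> fun_prop
  · simp
  · simp [rot]
  · refine x.rot_isInvMor _ _ ?_
    norm_cast
    have := Real.cos_sq_add_sin_sq (Real.pi / 2 * t)
    nlinarith

theorem sum_inv_iso_rot (x : Triple φ ι) : Iso (x.sum x.inv) x.rot := by
  refine ⟨Matrix.fromBlocks x.p 0 0 x.q, Matrix.fromBlocks 0 x.p (-x.q) 0,
    .refl (x.sum x.inv).hp, ⟨⟨?_, ?_⟩, Matrix.fromBlocks 0 (-x.q) x.p 0, ⟨?_, ?_⟩, ?_, ?_⟩, ?_⟩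
  · simp [rot, Matrix.fromBlocks_multiply, hp, hq]
  · simp [sum, inv, Matrix.fromBlocks_multiply, hp, hq]
  · simp [sum, inv, Matrix.fromBlocks_multiply, hp, hq]
  · simp [rot, Matrix.fromBlocks_multiply, hp, hq]
  · simp [rot, Matrix.fromBlocks_multiply, hp, hq]
  · simp [sum, inv, Matrix.fromBlocks_multiply, hp, hq]
  · have h1 : x.q.map φ * x.a = x.a := x.isInvMor_a.1.1
    have h2 : x.a * x.p.map φ = x.a := x.isInvMor_a.1.2
    have h3 : x.p.map φ * x.inv.a = x.inv.a := x.inv.isInvMor_a.1.1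
    have h4 : x.inv.a * x.q.map φ = x.inv.a := x.inv.isInvMor_a.1.2
    have hn : (-x.q).map φ = -(x.q.map φ) := by ext; simp
    simp [sum, rot, Matrix.fromBlocks_map, Matrix.fromBlocks_multiply, hn, h1, h2, h3, h4]

section Functoriality

variable {R' : Type u'} {S' : Type v'} [Ring R'] [StarRing R'] [Algebra ℂ R'] [CStarAlgebra S']
  {ψ : R' →⋆ₐ[ℂ] S'}

/-- The image `(f(p), f(q), g(a))` of a triple under a commutative square `g ∘ φ = ψ ∘ f`. -/
def map (f : R →⋆ₐ[ℂ] R') (g : S →⋆ₐ[ℂ] S') (hfg : ∀ r, g (φ r) = ψ (f r))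
    (x : Triple φ ι) : Triple ψ ι where
  p := x.p.map f
  q := x.q.map f
  a := x.a.map g
  isStarProjection_p := by
    refine ⟨?_, ?_⟩
    · rw [IsIdempotentElem, ← Matrix.map_mul, x.hp]
    · have h1 := x.isStarProjection_p.isSelfAdjoint.star_eq
      rw [IsSelfAdjoint, Matrix.star_eq_conjTranspose,
        ← Matrix.conjTranspose_map _ (fun r => map_star f r), ← Matrix.star_eq_conjTranspose, h1]
  isStarProjection_q := by
    refine ⟨?_, ?_⟩
    · rw [IsIdempotentElem, ← Matrix.map_mul, x.hq]
    · have h1 := x.isStarProjection_q.isSelfAdjoint.star_eq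
      rw [IsSelfAdjoint, Matrix.star_eq_conjTranspose,
        ← Matrix.conjTranspose_map _ (fun r => map_star f r), ← Matrix.star_eq_conjTranspose, h1]
  isInvMor_a := by
    have h := x.isInvMor_a.map (g : S →+* S')
    have e : ∀ m : Matrix ι ι R, (m.map f).map ψ = (m.map φ).map g := by
      intro m; ext i j; simp [hfg]
    rw [e, e]
    exact h

variable (f : R →⋆ₐ[ℂ] R') (g : S →⋆ₐ[ℂ] S') (hfg : ∀ r, g (φ r) = ψ (f r))

theorem Iso.map {x : Triple φ ι} {y : Triple φ κ} (h : Iso x y) :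
    Iso (x.map f g hfg) (y.map f g hfg) := by
  obtain ⟨c, d, hc, hd, e⟩ := h
  refine ⟨c.map f, d.map f, hc.map (f : R →+* R'), hd.map (f : R →+* R'), ?_⟩
  have k : ∀ m : Matrix κ ι R, (m.map f).map ψ = (m.map φ).map g := by
    intro m; ext i j; simp [hfg]
  rw [k, k]
  simp only [Triple.map]
  rw [← Matrix.map_mul, ← Matrix.map_mul, e]

theorem Elementary.map {x : Triple φ ι} (hx : x.Elementary) : (x.map f g hfg).Elementary := by
  obtain ⟨hx1, γ, hγ⟩ := hx
  have hg : Continuous g := by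
    open scoped CStarAlgebra in exact map_continuous g
  have k : (x.map f g hfg).p.map ψ = (x.p.map φ).map g := by
    ext i j; simp [Triple.map, hfg]
  refine ⟨by simp [Triple.map, hx1], ?_⟩
  rw [k]
  refine ⟨⟨⟨fun t => (γ t).map g, ?_⟩, ?_, ?_⟩, fun t => ?_⟩
  · exact Continuous.matrix_map γ.continuous hg
  · simp
  · simp [Triple.map]
  · exact (hγ t).map (g : S →+* S')

theorem map_sum (x : Triple φ ι) (y : Triple φ κ) :
    (x.sum y).map f g hfg = (x.map f g hfg).sum (y.map f g hfg) := by
  ext i j <;> rcases i with i | i <;> rcases j with j | j <;> simp [map, sum]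

theorem map_reindex (e : ι ≃ κ) (x : Triple φ ι) :
    (x.reindex e).map f g hfg = (x.map f g hfg).reindex e := by
  ext i j <;> simp [map, reindex]

end Functoriality

end Triple

/-- The set `Γ` of all triples `(p, q, a)` of matrices of an arbitrary finite size. -/
def Gam (φ : R →⋆ₐ[ℂ] S) : Type (max u v) := Σ n : ℕ, Triple φ (Fin n)

namespace Gam

variable {φ : R →⋆ₐ[ℂ] S}

/-- The direct sum `(p ⊕ p', q ⊕ q', a ⊕ a')`, of size `m + n` if the summands have sizes
`m` and `n`. -/
def add (x y : Gam φ) : Gam φ := ⟨x.1 + y.1, (x.2.sum y.2).reindex finSumFinEquiv⟩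

/-- The triple `(0, 0, 0)`, realised in size `0`. -/
def zero (φ : R →⋆ₐ[ℂ] S) : Gam φ := ⟨0, Triple.zero φ (Fin 0)⟩

/-- Isomorphism of triples. -/
def Iso (x y : Gam φ) : Prop := Triple.Iso x.2 y.2

/-- Elementary triples. -/
def Elementary (x : Gam φ) : Prop := x.2.Elementary

/-- The equivalence relation on triples: `x ∼ y` if `x ⊕ e` is isomorphic to `y ⊕ f` for some
elementary triples `e` and `f`. -/
def Equivalent (x y : Gam φ) : Prop :=
  ∃ e f : Gam φ, e.Elementary ∧ f.Elementary ∧ Iso (x.add e) (y.add f)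

theorem add_iso_sum (x y : Gam φ) : Triple.Iso (x.add y).2 (x.2.sum y.2) :=
  (Triple.iso_reindex finSumFinEquiv (x.2.sum y.2)).symm

theorem Iso.refl (x : Gam φ) : Iso x x := Triple.Iso.refl _

theorem Iso.symm {x y : Gam φ} (h : Iso x y) : Iso y x := Triple.Iso.symm h

theorem Iso.trans {x y z : Gam φ} (h : Iso x y) (k : Iso y z) : Iso x z := Triple.Iso.trans h k

theorem Iso.add {x y z w : Gam φ} (h : Iso x y) (k : Iso z w) : Iso (x.add z) (y.add w) :=
  ((add_iso_sum x z).trans (Triple.Iso.sum h k)).trans (add_iso_sum y w).symm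

theorem add_comm_iso (x y : Gam φ) : Iso (x.add y) (y.add x) :=
  ((add_iso_sum x y).trans (Triple.sum_comm_iso _ _)).trans (add_iso_sum y x).symm

theorem add_assoc_iso (x y z : Gam φ) : Iso ((x.add y).add z) (x.add (y.add z)) :=
  ((((add_iso_sum (x.add y) z).trans ((add_iso_sum x y).sum (.refl z.2))).trans
    (Triple.sum_assoc_iso _ _ _)).trans ((Triple.Iso.refl x.2).sum (add_iso_sum y z).symm)).trans
    (add_iso_sum x (y.add z)).symm

theorem add_zero_iso (x : Gam φ) : Iso (x.add (zero φ)) x :=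
  (add_iso_sum x (zero φ)).trans (Triple.sum_zero_iso (κ := Fin 0) x.2)

theorem add_add_add_comm_iso (x y z w : Gam φ) :
    Iso ((x.add y).add (z.add w)) ((x.add z).add (y.add w)) := by
  have h : Iso (y.add (z.add w)) (z.add (y.add w)) :=
    ((add_assoc_iso y z w).symm.trans ((add_comm_iso y z).add (.refl w))).trans
      (add_assoc_iso z y w)
  exact ((add_assoc_iso x y _).trans ((Iso.refl x).add h)).trans (add_assoc_iso x z _).symm

theorem Elementary.add {x y : Gam φ} (hx : x.Elementary) (hy : y.Elementary) :
    (x.add y).Elementary :=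
  (Triple.Elementary.sum hx hy).reindex finSumFinEquiv

theorem zero_elementary : (zero φ).Elementary := Triple.zero_elementary

theorem Iso.equivalent {x y : Gam φ} (h : Iso x y) : Equivalent x y :=
  ⟨zero φ, zero φ, zero_elementary, zero_elementary, h.add (.refl _)⟩

theorem Elementary.equivalent_zero {x : Gam φ} (h : x.Elementary) : Equivalent x (zero φ) :=
  ⟨zero φ, x, zero_elementary, h, add_comm_iso _ _⟩

theorem Equivalent.refl (x : Gam φ) : Equivalent x x := (Iso.refl x).equivalent

theorem Equivalent.symm {x y : Gam φ} (h : Equivalent x y) : Equivalent y x := by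
  obtain ⟨e, f, he, hf, i⟩ := h
  exact ⟨f, e, hf, he, Iso.symm i⟩

theorem Equivalent.trans {x y z : Gam φ} (h : Equivalent x y) (k : Equivalent y z) :
    Equivalent x z := by
  obtain ⟨e, f, he, hf, i⟩ := h
  obtain ⟨e', f', he', hf', i'⟩ := k
  refine ⟨e.add e', f'.add f, he.add he', hf'.add hf, ?_⟩
  have i1 : Iso (x.add (e.add e')) ((y.add f).add e') :=
    (add_assoc_iso x e e').symm.trans (i.add (.refl e'))
  have i2 : Iso ((y.add f).add e') ((y.add e').add f) :=
    ((add_assoc_iso y f e').trans ((Iso.refl y).add (add_comm_iso f e'))).trans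
      (add_assoc_iso y e' f).symm
  exact (i1.trans i2).trans ((i'.add (.refl f)).trans (add_assoc_iso z f' f))

theorem Equivalent.add {x y z w : Gam φ} (h : Equivalent x y) (k : Equivalent z w) :
    Equivalent (x.add z) (y.add w) := by
  obtain ⟨e, f, he, hf, i⟩ := h
  obtain ⟨e', f', he', hf', i'⟩ := k
  exact ⟨e.add e', f.add f', he.add he', hf.add hf',
    ((add_add_add_comm_iso x z e e').trans (i.add i')).trans (add_add_add_comm_iso y f w f')⟩

theorem exists_add_equivalent_zero (x : Gam φ) :
    ∃ y : Gam φ, Equivalent (y.add x) (zero φ) := by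
  refine ⟨⟨x.1, x.2.inv⟩, ?_⟩
  have h1 : Iso (x.add ⟨x.1, x.2.inv⟩) ⟨x.1 + x.1, x.2.rot.reindex finSumFinEquiv⟩ :=
    ((add_iso_sum x ⟨x.1, x.2.inv⟩).trans x.2.sum_inv_iso_rot).trans
      (Triple.iso_reindex finSumFinEquiv x.2.rot)
  have h2 : Elementary (φ := φ) ⟨x.1 + x.1, x.2.rot.reindex finSumFinEquiv⟩ :=
    x.2.rot_elementary.reindex finSumFinEquiv
  exact ((add_comm_iso _ _).trans h1).equivalent.trans h2.equivalent_zero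

/-- The setoid of the equivalence relation on triples. -/
instance setoid (φ : R →⋆ₐ[ℂ] S) : Setoid (Gam φ) :=
  ⟨Equivalent, Equivalent.refl, Equivalent.symm, Equivalent.trans⟩

end Gam

/-- Karoubi's relative group of a unital `*`-homomorphism `φ`: equivalence classes `[p, q, a]`
of triples. -/
def K0 (φ : R →⋆ₐ[ℂ] S) : Type (max u v) := Quotient (Gam.setoid φ)

namespace K0

variable {φ : R →⋆ₐ[ℂ] S}

/-- The class `[p, q, a]` of a triple. -/
def mk (x : Gam φ) : K0 φ := Quotient.mk (Gam.setoid φ) x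

/-- Addition is `[p, q, a] + [p', q', a'] = [p ⊕ p', q ⊕ q', a ⊕ a']`. -/
instance : Add (K0 φ) :=
  ⟨Quotient.map₂ Gam.add fun _ _ h _ _ k => Gam.Equivalent.add h k⟩

/-- The neutral element is `[0, 0, 0]`. -/
instance : Zero (K0 φ) := ⟨mk (Gam.zero φ)⟩

theorem mk_add (x y : Gam φ) : mk (x.add y) = mk x + mk y := rfl

theorem exists_neg (x : K0 φ) : ∃ y : K0 φ, y + x = 0 := by
  induction x using Quotient.inductionOn with
  | h x =>
    obtain ⟨y, hy⟩ := x.exists_add_equivalent_zero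
    exact ⟨mk y, Quotient.sound hy⟩

/-- The negative is chosen as some inverse; additive inverses being unique, the negative of
`[p, q, a]` is `[q, p, a⁻¹]`. -/
noncomputable instance : Neg (K0 φ) := ⟨fun x => (exists_neg x).choose⟩

/-- The group structure. -/
noncomputable instance : AddCommGroup (K0 φ) where
  add_assoc x y z := by
    induction x, y using Quotient.inductionOn₂ with
    | h x y =>
      induction z using Quotient.inductionOn with
      | h z => exact Quotient.sound (Gam.add_assoc_iso x y z).equivalent
  add_comm x y := by
    induction x, y using Quotient.inductionOn₂ with
    | h x y => exact Quotient.sound (Gam.add_comm_iso x y).equivalent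
  zero_add x := by
    induction x using Quotient.inductionOn with
    | h x =>
      exact Quotient.sound ((Gam.add_comm_iso _ _).trans (Gam.add_zero_iso x)).equivalent
  add_zero x := by
    induction x using Quotient.inductionOn with
    | h x => exact Quotient.sound (Gam.add_zero_iso x).equivalent
  neg_add_cancel x := (exists_neg x).choose_spec
  nsmul := nsmulRec
  zsmul := zsmulRec

section Functoriality

variable {R' : Type u'} {S' : Type v'} [Ring R'] [StarRing R'] [Algebra ℂ R'] [CStarAlgebra S']
  {ψ : R' →⋆ₐ[ℂ] S'}

/-- The homomorphism `[p, q, a] ↦ [f(p), f(q), g(a)]` induced by a commutative square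
`g ∘ φ = ψ ∘ f`. -/
noncomputable def map (f : R →⋆ₐ[ℂ] R') (g : S →⋆ₐ[ℂ] S') (hfg : ∀ r, g (φ r) = ψ (f r)) :
    K0 φ →+ K0 ψ :=
  have hadd : ∀ x y : Gam φ,
      (⟨(x.add y).1, (x.add y).2.map f g hfg⟩ : Gam ψ) =
        Gam.add ⟨x.1, x.2.map f g hfg⟩ ⟨y.1, y.2.map f g hfg⟩ := fun x y => by
    simp [Gam.add, Triple.map_sum, Triple.map_reindex]
  AddMonoidHom.mk'
    (Quotient.map (fun x : Gam φ => (⟨x.1, x.2.map f g hfg⟩ : Gam ψ)) (by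
      rintro x y ⟨d, e, hd, he, i⟩
      refine ⟨⟨d.1, d.2.map f g hfg⟩, ⟨e.1, e.2.map f g hfg⟩, hd.map f g hfg, he.map f g hfg, ?_⟩
      rw [← hadd, ← hadd]
      exact Triple.Iso.map f g hfg i))
    (by
      intro x y
      induction x, y using Quotient.inductionOn₂ with
      | h x y => exact congrArg mk (hadd x y))

theorem map_mk (f : R →⋆ₐ[ℂ] R') (g : S →⋆ₐ[ℂ] S') (hfg : ∀ r, g (φ r) = ψ (f r)) (x : Gam φ) :
    map f g hfg (mk x) = mk ⟨x.1, x.2.map f g hfg⟩ := rfl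

end Functoriality

end K0

end Triples

section Pairs

variable {A : Type u} [NonUnitalCStarAlgebra A] {B : Type v} [NonUnitalCStarAlgebra B]

/-- The unital inclusion of the unitization of `A'` in the unitization of `A`. -/
noncomputable def unitalInclusion (A' : NonUnitalStarSubalgebra ℂ A) :
    Unitization ℂ A' →⋆ₐ[ℂ] Unitization ℂ A :=
  Unitization.starMap (NonUnitalStarSubalgebraClass.subtype A')

/-- The relative group `K₀(A'; A)`: the projections live in matrices over the unitization of `A'`,
the invertible morphisms between them in matrices over the unitization of `A`. -/
abbrev RelK0 (A' : NonUnitalStarSubalgebra ℂ A) : Type u := K0 (unitalInclusion A')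

/-- The restriction `A' → B'` of a `*`-homomorphism `π : A → B` with `π(A') ⊆ B'`. -/
def restrict (π : A →⋆ₙₐ[ℂ] B) {A' : NonUnitalStarSubalgebra ℂ A}
    {B' : NonUnitalStarSubalgebra ℂ B} (h : ∀ a ∈ A', π a ∈ B') : A' →⋆ₙₐ[ℂ] B' :=
  NonUnitalStarAlgHom.codRestrict (π.comp (NonUnitalStarSubalgebraClass.subtype A')) B'
    fun a => h a a.2

/-- The homomorphism `π_* : K₀(A'; A) → K₀(B'; B)` induced by a `*`-homomorphism `π : A → B` with
`π(A') ⊆ B'`, obtained by applying the unital extension of `π` to the entries of matrices. -/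
noncomputable def RelK0.map (π : A →⋆ₙₐ[ℂ] B) {A' : NonUnitalStarSubalgebra ℂ A}
    {B' : NonUnitalStarSubalgebra ℂ B} (h : ∀ a ∈ A', π a ∈ B') : RelK0 A' →+ RelK0 B' :=
  K0.map (Unitization.starMap (restrict π h)) (Unitization.starMap π) fun r => by
    have e : (Unitization.starMap π).comp (unitalInclusion A') =
        (unitalInclusion B').comp (Unitization.starMap (restrict π h)) := by
      rw [unitalInclusion, unitalInclusion, ← Unitization.starMap_comp, ← Unitization.starMap_comp]
      rfl
    exact DFunLike.congr_fun e r

end Pairs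

end KaroubiRel

/-!
# Excision for Karoubi's relative group

Since `C'/A' = C/A = D`, the ring `Ã'` consists of the elements of `C̃'` whose image in `D̃` is a
complex scalar, and likewise `Ã` consists of the elements of `C̃` with scalar image in `D̃`.
Descending a matrix from `C` to `A` therefore means making its image over `D̃` scalar.  Adding the
elementary triple on `1 - p` turns every triple into one of the form `(1, Q, a)`, where `a` is a
rectangular matrix; throughout, isomorphisms are taken between idempotents, which is harmless
because every idempotent over a C⋆-algebra is isomorphic to a projection
(`exists_isStarProjection_isInvMor`).

*Surjectivity.* For a triple `(1, Q, a)` over `C`, the image of `a` over `D̃` is an isomorphism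
`α : 1 → σ(Q)` with inverse `β`.  The product of elementary matrices
`E₁₂(β) E₂₁(-α) E₁₂(β)` carries `0 ⊕ σ(Q)` to `1 ⊕ 0` and the column `(0, α)` to
the scalar column `(1, 0)`.
Elementary matrices lift along the surjection `C̃' → D̃`, and the lift carries `(1, Q, a)` to a
triple defined over `A` (`exists_isInvMor_lift`, `exists_descent_of_isInvMor`).

*Injectivity.* The class of `(1, Q, a)` vanishes exactly if, after adding some identity matrix,
`a = g u` with `g` an isomorphism over the small algebra and `u` in the path component of the
identity (`exists_of_mk_eq_zero`, `mk_eq_zero_of_eq_mul`).  Suppose this holds over `C`.  The matrix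
`u` is a product of exponentials `exp(xᵢ)`.  Lifting the images of the `xᵢ` over `D̃` to `C̃'`
yields an invertible `h` over `C̃'` such that `h⁻¹ u` is joined to `1` by matrices with image `1` over
`D̃`, that is, by matrices over `Ã` (`exists_lift_of_joinedIn`).  Then `g h` has the same scalar
image over `D̃` as `a`, so it lies over `Ã'`, and `a = (g h)(h⁻¹ u)` is a factorization over `A`
(`exists_descent_of_eq_mul`).
-/

namespace KaroubiRel

open NormedSpace

/-! ### Exponentials and path components in Banach algebras -/

section BanachAlgebra

theorem joinedIn_isUnit_mul {B : Type*} [NormedRing B] {v w : B}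
    (hv : JoinedIn {w : B | IsUnit w} 1 v)
    (hw : JoinedIn {w : B | IsUnit w} 1 w) : JoinedIn {w : B | IsUnit w} 1 (v * w) := by
  have h := hv.mul hw
  rw [mul_one] at h
  refine h.mono ?_
  rintro _ ⟨a, ha, b, hb, rfl⟩
  exact IsUnit.mul ha hb

theorem joinedIn_isUnit_inv {B : Type*} [NormedRing B] [CompleteSpace B] (u : Bˣ)
    (hu : JoinedIn {w : B | IsUnit w} 1 (u : B)) :
    JoinedIn {w : B | IsUnit w} 1 ((u⁻¹ : Bˣ) : B) := by
  have hc : ContinuousOn (Ring.inverse : B → B) {w : B | IsUnit w} := by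
    rintro _ ⟨w, rfl⟩
    exact (NormedRing.inverse_continuousAt w).continuousWithinAt
  have h := hu.map_continuousOn hc
  rw [Ring.inverse_one, Ring.inverse_unit] at h
  refine h.mono ?_
  rintro _ ⟨_, ⟨w, rfl⟩, rfl⟩
  rw [Ring.inverse_unit]
  exact (w⁻¹).isUnit

variable {P B T : Type*}
  [NormedRing P] [NormedAlgebra ℂ P] [CompleteSpace P]
  [NormedRing B] [NormedAlgebra ℂ B] [CompleteSpace B]
  [NormedRing T] [NormedAlgebra ℂ T] [CompleteSpace T]

theorem exp_mul_exp_neg (x : B) : exp x * exp (-x) = 1 := by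
  let _ : NormedAlgebra ℚ B := NormedAlgebra.restrictScalars ℚ ℂ B
  rw [← exp_add_of_commute (Commute.neg_right (Commute.refl x)), add_neg_cancel, exp_zero]

/-- The exponential of an element of a complex Banach algebra, as an invertible element. -/
noncomputable def expUnit (x : B) : Bˣ where
  val := exp x
  inv := exp (-x)
  val_inv := exp_mul_exp_neg x
  inv_val := by simpa using exp_mul_exp_neg (-x)

theorem continuous_expUnit : Continuous (expUnit : B → Bˣ) := by
  let _ : NormedAlgebra ℚ B := NormedAlgebra.restrictScalars ℚ ℂ B
  exact Units.continuous_iff.2 ⟨exp_continuous, exp_continuous.comp continuous_neg⟩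

theorem expUnit_zero : expUnit (0 : B) = 1 := Units.ext exp_zero

theorem map_expUnit (f : B →ₐ[ℂ] T) (hf : Continuous f) (x : B) :
    Units.map (f : B →* T) (expUnit x) = expUnit (f x) := by
  let _ : NormedAlgebra ℚ B := NormedAlgebra.restrictScalars ℚ ℂ B
  let _ : NormedAlgebra ℚ T := NormedAlgebra.restrictScalars ℚ ℂ T
  exact Units.ext (map_exp f hf x)

theorem range_expUnit_mem_nhds_one : Set.range (expUnit : B → Bˣ) ∈ nhds (1 : Bˣ) := by
  have h : HasStrictFDerivAt (exp : B → B)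
      ((ContinuousLinearEquiv.refl ℂ B : B ≃L[ℂ] B) : B →L[ℂ] B) 0 :=
    hasStrictFDerivAt_exp_zero
  have h1 : Set.range (exp : B → B) ∈ nhds (1 : B) := by
    rw [← exp_zero (𝔸 := B), ← h.map_nhds_eq_of_equiv]
    exact Filter.range_mem_map
  filter_upwards [Units.continuous_val.tendsto (1 : Bˣ) h1]
  rintro u ⟨x, hx⟩
  exact ⟨x, Units.ext hx⟩

/-- A subgroup of the invertible group of a Banach algebra that contains all exponentials contains
the path component of `1`, because it is open and hence closed. -/
theorem mem_of_joinedIn_isUnit (G : Subgroup Bˣ) (hG : ∀ x : B, expUnit x ∈ G) (u : Bˣ)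
    (hu : JoinedIn {w : B | IsUnit w} 1 (u : B)) : u ∈ G := by
  have hopen : IsOpen (G : Set Bˣ) := G.isOpen_of_mem_nhds
    (Filter.mem_of_superset range_expUnit_mem_nhds_one (Set.range_subset_iff.2 hG))
  have hclosed : IsClosed (G : Set Bˣ) := G.isClosed_of_isOpen hopen
  obtain ⟨γ, hγ⟩ := hu
  have hγ' : ∀ t, ∃ v : Bˣ, (v : B) = γ t := hγ
  choose δ hδ using hγ'
  have hcont : Continuous δ := by
    rw [Units.isOpenEmbedding_val.isEmbedding.continuous_iff]
    exact γ.continuous.congr fun t => (hδ t).symm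
  have h0 : δ 0 = 1 := Units.ext (by rw [hδ, γ.source, Units.val_one])
  have h1 : δ 1 = u := Units.ext (by rw [hδ, γ.target])
  have huniv : δ ⁻¹' (G : Set Bˣ) = Set.univ :=
    IsClopen.eq_univ ⟨hclosed.preimage hcont, hopen.preimage hcont⟩
      ⟨0, by rw [Set.mem_preimage, h0]; exact G.one_mem⟩
  have : (1 : unitInterval) ∈ δ ⁻¹' (G : Set Bˣ) := huniv ▸ Set.mem_univ _
  rwa [Set.mem_preimage, h1] at this

/-- If `u` is joined to `1` by invertible elements of `B`, then its image in `T` lifts to an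
invertible element `h` of `P` in such a way that `φ(h)⁻¹ u` is joined to `1` inside the kernel of
`Bˣ → Tˣ`.  For `u = exp x` one takes `h = exp y` with `σ y = τ x` and the path
`exp (-t φ(y)) exp (t x)`; the elements with this property form a subgroup. -/
theorem exists_lift_of_joinedIn (φ : P →ₐ[ℂ] B) (σ : P →ₐ[ℂ] T) (τ : B →ₐ[ℂ] T)
    (hφ : Continuous φ) (hτ : Continuous τ) (hτφ : ∀ r, τ (φ r) = σ r)
    (hsurj : Function.Surjective σ) (u : Bˣ) (hu : JoinedIn {w : B | IsUnit w} 1 (u : B)) :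
    ∃ h : Pˣ, JoinedIn ((Units.map (τ : B →* T)).ker : Set Bˣ) 1
      ((Units.map (φ : P →* B) h)⁻¹ * u) := by
  set K : Subgroup Bˣ := (Units.map (τ : B →* T)).ker
  have hKn : K.Normal := inferInstance
  have conj : ∀ g n : Bˣ, JoinedIn (K : Set Bˣ) 1 n → JoinedIn (K : Set Bˣ) 1 (g * n * g⁻¹) := by
    intro g n hn
    have h := hn.map (f := fun w => g * w * g⁻¹) (by fun_prop)
    rw [mul_one, mul_inv_cancel] at h
    refine h.mono ?_
    rintro _ ⟨w, hw, rfl⟩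
    exact hKn.conj_mem w hw g
  have mul : ∀ m n : Bˣ, JoinedIn (K : Set Bˣ) 1 m → JoinedIn (K : Set Bˣ) 1 n →
      JoinedIn (K : Set Bˣ) 1 (m * n) := by
    intro m n hm hn
    have h := hm.mul hn
    rw [mul_one] at h
    refine h.mono ?_
    rintro _ ⟨v, hv, w, hw, rfl⟩
    exact K.mul_mem hv hw
  have inv : ∀ m : Bˣ, JoinedIn (K : Set Bˣ) 1 m → JoinedIn (K : Set Bˣ) 1 m⁻¹ := by
    intro m hm
    have h := hm.map (f := fun w => w⁻¹) continuous_inv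
    rw [inv_one] at h
    refine h.mono ?_
    rintro _ ⟨v, hv, rfl⟩
    exact K.inv_mem hv
  let G : Subgroup Bˣ :=
    { carrier := {u | ∃ h : Pˣ, JoinedIn (K : Set Bˣ) 1 ((Units.map (φ : P →* B) h)⁻¹ * u)}
      one_mem' := ⟨1, by simpa using JoinedIn.refl K.one_mem⟩
      mul_mem' := by
        rintro u v ⟨h, hu⟩ ⟨k, hv⟩
        refine ⟨h * k, ?_⟩
        have := mul _ _ (conj (Units.map (φ : P →* B) k)⁻¹ _ hu) hv
        convert this using 1
        rw [map_mul]
        group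
      inv_mem' := by
        rintro u ⟨h, hu⟩
        refine ⟨h⁻¹, ?_⟩
        have := conj (Units.map (φ : P →* B) h) _ (inv _ hu)
        convert this using 1
        rw [map_inv]
        group }
  refine mem_of_joinedIn_isUnit G (fun x => ?_) u hu
  obtain ⟨y, hy⟩ := hsurj (τ x)
  refine ⟨expUnit y, ?_⟩
  have hinv : ∀ z : B, (expUnit z)⁻¹ = expUnit (-z) := fun z => Units.ext rfl
  rw [map_expUnit φ hφ, hinv]
  refine JoinedIn.ofLine (f := fun t : ℝ => expUnit (-((t : ℂ) • φ y)) * expUnit ((t : ℂ) • x))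
    ?_ ?_ ?_ ?_
  · refine Continuous.continuousOn ?_
    exact (continuous_expUnit.comp (by fun_prop)).mul (continuous_expUnit.comp (by fun_prop))
  · simp [expUnit_zero]
  · simp
  · rintro _ ⟨t, -, rfl⟩
    have hT : ∀ z : T, (expUnit (-z)) = (expUnit z)⁻¹ := fun z => Units.ext rfl
    have h1 : τ (-((t : ℂ) • φ y)) = -((t : ℂ) • τ x) := by rw [map_neg, map_smul, hτφ, hy]
    rw [SetLike.mem_coe, MonoidHom.mem_ker, map_mul, map_expUnit τ hτ, map_expUnit τ hτ, h1, hT,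
      map_smul, inv_mul_cancel]

end BanachAlgebra

/-! ### Idempotents and projections -/

section Projection

/-- In a unital C⋆-algebra, every idempotent `e` has a self-adjoint idempotent `p` with the same
range, namely `p = e e⋆ h⁻¹` where `h = 1 + (e - e⋆)(e - e⋆)⋆` commutes with `e` and `e⋆`. -/
theorem exists_isStarProjection_of_isIdempotentElem {B : Type*} [CStarAlgebra B] {e : B}
    (he : e * e = e) : ∃ p : B, IsStarProjection p ∧ e * p = p ∧ p * e = e := by
  have he' : star e * star e = star e := by rw [← star_mul, he]
  have hu : IsUnit (1 + star (star e - e) * (star e - e)) := by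
    have h : (-1 : ℝ) ∉ spectrum ℝ (star (star e - e) * (star e - e)) := fun h => by
      have := spectrum_star_mul_self_nonneg _ h
      linarith
    rw [spectrum.notMem_iff] at h
    rw [← IsUnit.neg_iff]
    convert h using 1
    rw [map_neg, map_one, neg_add, ← sub_eq_add_neg]
  obtain ⟨h, hh⟩ := hu
  have hval : (h : B) = 1 + e * star e - e - star e + star e * e := by
    rw [hh, star_sub, star_star]
    simp only [sub_mul, mul_sub, he, he']
    abel
  have c1 : e * (h : B) = e * star e * e := by
    rw [hval]
    simp only [mul_add, mul_sub, mul_one, ← mul_assoc, he]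
    abel
  have c2 : (h : B) * e = e * star e * e := by
    rw [hval]
    simp only [add_mul, sub_mul, one_mul, mul_assoc, he]
    abel
  have hsa : star (h : B) = h := by
    rw [hh, star_add, star_one, star_mul, star_star]
  have c3 : star e * (h : B) = (h : B) * star e := by
    have := congrArg star (c1.trans c2.symm)
    rw [star_mul, star_mul, hsa] at this
    exact this.symm
  have d1 : Commute e (↑h⁻¹ : B) := Commute.units_inv_right (c1.trans c2.symm)
  have d2 : Commute (star e) (↑h⁻¹ : B) := Commute.units_inv_right c3
  have hsa' : star (↑h⁻¹ : B) = ↑h⁻¹ := by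
    rw [← Units.coe_star_inv]
    congr 2
    exact Units.ext hsa
  refine ⟨e * star e * ↑h⁻¹, ⟨?_, ?_⟩, ?_, ?_⟩
  · calc e * star e * ↑h⁻¹ * (e * star e * ↑h⁻¹)
        = e * star e * (↑h⁻¹ * e) * star e * ↑h⁻¹ := by noncomm_ring
      _ = (e * star e * e) * (↑h⁻¹ * star e) * ↑h⁻¹ := by rw [← d1.eq]; noncomm_ring
      _ = e * (↑h * ↑h⁻¹) * star e * ↑h⁻¹ := by rw [← c1]; noncomm_ring
      _ = e * star e * ↑h⁻¹ := by rw [Units.mul_inv, mul_one]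
  · rw [IsSelfAdjoint, star_mul, star_mul, star_star, hsa']
    rw [← mul_assoc, ← d1.eq, mul_assoc, ← d2.eq, mul_assoc]
  · rw [← mul_assoc, ← mul_assoc, he]
  · rw [mul_assoc, ← d1.eq, ← mul_assoc, ← c1, mul_assoc, Units.mul_inv, mul_one]

variable {R : Type*} [CStarAlgebra R] {ι : Type} [Fintype ι]

/-- Every idempotent matrix over a C⋆-algebra is isomorphic to a projection of the same size. -/
theorem exists_isStarProjection_isInvMor {e : Matrix ι ι R} (he : e * e = e) :
    ∃ p : Matrix ι ι R, IsStarProjection p ∧ IsInvMor p e p := by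
  classical
  let _ := CStarAlgebra.spectralOrder R
  have _ := CStarAlgebra.spectralOrderedRing R
  obtain ⟨p, hp, h1, h2⟩ := exists_isStarProjection_of_isIdempotentElem
    (B := CStarMatrix ι ι R) (e := CStarMatrix.ofMatrix e) he
  have h1' : e * (CStarMatrix.ofMatrix.symm p) = CStarMatrix.ofMatrix.symm p := h1
  have h2' : (CStarMatrix.ofMatrix.symm p) * e = e := h2
  have hp1 : (CStarMatrix.ofMatrix.symm p) * (CStarMatrix.ofMatrix.symm p) =
    CStarMatrix.ofMatrix.symm p := hp.isIdempotentElem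
  exact ⟨CStarMatrix.ofMatrix.symm p, ⟨hp.isIdempotentElem, hp.isSelfAdjoint⟩,
    ⟨h1', hp1⟩, e, ⟨h2', he⟩, h2', by rw [h1']⟩

end Projection

/-! ### Invertible morphisms -/

section Morphisms

variable {R : Type*} [Ring R] {ι κ μ : Type} [Fintype ι] [Fintype κ] [Fintype μ]

theorem IsInvMor.exists_inv {p : Matrix ι ι R} {q : Matrix κ κ R} {a : Matrix κ ι R}
    (h : IsInvMor p q a) : ∃ b : Matrix ι κ R, IsInvMor q p b ∧ a * b = q ∧ b * a = p := by
  obtain ⟨h1, b, h2, h3, h4⟩ := h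
  exact ⟨b, ⟨h2, a, h1, h4, h3⟩, h3, h4⟩

theorem IsInvMor.source_mul_self {p : Matrix ι ι R} {q : Matrix κ κ R} {a : Matrix κ ι R}
    (h : IsInvMor p q a) : p * p = p := by
  obtain ⟨h1, b, h2, h3, h4⟩ := h
  rw [← h4, Matrix.mul_assoc, ← Matrix.mul_assoc a, h3, h1.1]

theorem IsInvMor.target_mul_self {p : Matrix ι ι R} {q : Matrix κ κ R} {a : Matrix κ ι R}
    (h : IsInvMor p q a) : q * q = q :=
  let ⟨_, hb, _⟩ := h.exists_inv
  hb.source_mul_self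

variable [DecidableEq ι]

theorem isInvMor_one_iff {w : Matrix ι ι R} : IsInvMor 1 1 w ↔ IsUnit w := by
  constructor
  · rintro ⟨-, b, -, h1, h2⟩
    exact ⟨⟨w, b, h1, h2⟩, rfl⟩
  · rintro ⟨u, rfl⟩
    exact ⟨⟨one_mul _, mul_one _⟩, ↑u⁻¹, ⟨one_mul _, mul_one _⟩, u.mul_inv, u.inv_mul⟩

/-- `p ⊕ (1 - p)` is isomorphic to `1`, through the row `(p, 1 - p)`. -/
theorem isInvMor_fromCols_compl {p : Matrix ι ι R} (hp : p * p = p) :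
    IsInvMor (Matrix.fromBlocks p 0 0 (1 - p)) 1 (Matrix.fromCols p (1 - p)) := by
  have h1 : p * (1 - p) = 0 := by rw [mul_sub, mul_one, hp, sub_self]
  have h2 : (1 - p) * p = 0 := by rw [sub_mul, one_mul, hp, sub_self]
  have h3 : (1 - p) * (1 - p) = 1 - p := by rw [mul_sub, mul_one, h2, sub_zero]
  refine ⟨⟨Matrix.one_mul _, ?_⟩, Matrix.fromRows p (1 - p), ⟨?_, Matrix.mul_one _⟩, ?_, ?_⟩
  · simp [Matrix.fromCols_mul_fromBlocks, hp, h3]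
  · simp [Matrix.fromBlocks_mul_fromRows, hp, h3]
  · simp [Matrix.fromCols_mul_fromRows, hp, h3]
  · simp [hp, h1, h2, h3]

end Morphisms

/-! ### Isomorphisms between triples of idempotents of different sizes -/

section MorIso

variable {R : Type*} {S : Type*} [Ring R] [StarRing R] [Algebra ℂ R] [CStarAlgebra S]
  {φ : R →⋆ₐ[ℂ] S} {ι κ μ ν ι' κ' μ' ν' : Type} [Fintype ι] [Fintype κ] [Fintype μ] [Fintype ν]
  [Fintype ι'] [Fintype κ'] [Fintype μ'] [Fintype ν']

/-- Isomorphism of triples `(p, q, a)` and `(p', q', a')`, as in `Triple.Iso`, but for idempotents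
`p`, `q`, `p'`, `q'` that need not be self-adjoint nor have the same size. -/
def MorIso (φ : R →⋆ₐ[ℂ] S) (p : Matrix ι ι R) (q : Matrix κ κ R) (a : Matrix κ ι S)
    (p' : Matrix μ μ R) (q' : Matrix ν ν R) (a' : Matrix ν μ S) : Prop :=
  ∃ (c : Matrix μ ι R) (d : Matrix ν κ R),
    IsInvMor p p' c ∧ IsInvMor q q' d ∧ d.map φ * a = a' * c.map φ

theorem MorIso.trans {p : Matrix ι ι R} {q : Matrix κ κ R} {a : Matrix κ ι S}
    {p' : Matrix μ μ R} {q' : Matrix ν ν R} {a' : Matrix ν μ S}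
    {p'' : Matrix ι' ι' R} {q'' : Matrix κ' κ' R} {a'' : Matrix κ' ι' S}
    (h : MorIso φ p q a p' q' a') (k : MorIso φ p' q' a' p'' q'' a'') :
    MorIso φ p q a p'' q'' a'' := by
  obtain ⟨c, d, hc, hd, e⟩ := h
  obtain ⟨c', d', hc', hd', e'⟩ := k
  refine ⟨c' * c, d' * d, hc.comp hc', hd.comp hd', ?_⟩
  rw [Matrix.map_mul, Matrix.map_mul, Matrix.mul_assoc, e, ← Matrix.mul_assoc, e',
    Matrix.mul_assoc]

theorem MorIso.symm {p : Matrix ι ι R} {q : Matrix κ κ R} {a : Matrix κ ι S}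
    {p' : Matrix μ μ R} {q' : Matrix ν ν R} {a' : Matrix ν μ S}
    (h : MorIso φ p q a p' q' a') (ha : IsMor (p.map φ) (q.map φ) a)
    (ha' : IsMor (p'.map φ) (q'.map φ) a') : MorIso φ p' q' a' p q a := by
  obtain ⟨c, d, hc, hd, e⟩ := h
  obtain ⟨c', hc', e1, -⟩ := hc.exists_inv
  obtain ⟨d', hd', -, e4⟩ := hd.exists_inv
  refine ⟨c', d', hc', hd', ?_⟩
  have f1 : d'.map φ * d.map φ = q.map φ := by rw [← Matrix.map_mul, e4]
  have f2 : c.map φ * c'.map φ = p'.map φ := by rw [← Matrix.map_mul, e1]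
  calc d'.map φ * a' = d'.map φ * (a' * (c.map φ * c'.map φ)) := by rw [f2, ha'.2]
    _ = d'.map φ * d.map φ * a * c'.map φ := by
        rw [← Matrix.mul_assoc a', ← e]; simp only [Matrix.mul_assoc]
    _ = a * c'.map φ := by rw [f1, ha.1]

theorem MorIso.fromBlocks {p : Matrix ι ι R} {q : Matrix κ κ R} {a : Matrix κ ι S}
    {p' : Matrix μ μ R} {q' : Matrix ν ν R} {a' : Matrix ν μ S}
    {r : Matrix ι' ι' R} {s : Matrix κ' κ' R} {b : Matrix κ' ι' S}
    {r' : Matrix μ' μ' R} {s' : Matrix ν' ν' R} {b' : Matrix ν' μ' S}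
    (h : MorIso φ p q a p' q' a') (k : MorIso φ r s b r' s' b') :
    MorIso φ (Matrix.fromBlocks p 0 0 r) (Matrix.fromBlocks q 0 0 s) (Matrix.fromBlocks a 0 0 b)
      (Matrix.fromBlocks p' 0 0 r') (Matrix.fromBlocks q' 0 0 s')
      (Matrix.fromBlocks a' 0 0 b') := by
  obtain ⟨c, d, hc, hd, e⟩ := h
  obtain ⟨c', d', hc', hd', e'⟩ := k
  refine ⟨Matrix.fromBlocks c 0 0 c', Matrix.fromBlocks d 0 0 d', hc.fromBlocks hc',
    hd.fromBlocks hd', ?_⟩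
  simp [Matrix.fromBlocks_map, Matrix.fromBlocks_multiply, e, e']

theorem MorIso.map {R' S' : Type*} [Ring R'] [StarRing R'] [Algebra ℂ R'] [CStarAlgebra S']
    {ψ : R' →⋆ₐ[ℂ] S'} (f : R →⋆ₐ[ℂ] R') (g : S →⋆ₐ[ℂ] S') (hfg : ∀ r, g (φ r) = ψ (f r))
    {p : Matrix ι ι R} {q : Matrix κ κ R} {a : Matrix κ ι S}
    {p' : Matrix μ μ R} {q' : Matrix ν ν R} {a' : Matrix ν μ S}
    (h : MorIso φ p q a p' q' a') :
    MorIso ψ (p.map f) (q.map f) (a.map g) (p'.map f) (q'.map f) (a'.map g) := by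
  obtain ⟨c, d, hc, hd, e⟩ := h
  refine ⟨c.map f, d.map f, hc.map (f : R →+* R'), hd.map (f : R →+* R'), ?_⟩
  have k : ∀ {α β : Type} (m : Matrix α β R), (m.map f).map ψ = (m.map φ).map g := by
    intro α β m; ext i j; simp [hfg]
  rw [k, k, ← Matrix.map_mul, ← Matrix.map_mul, e]

theorem isInvMor_map {p : Matrix ι ι R} {q : Matrix κ κ R} {c : Matrix κ ι R}
    (h : IsInvMor p q c) : IsInvMor (p.map φ) (q.map φ) (c.map φ) :=
  h.map (φ : R →+* S)

theorem map_one_sub {ι : Type} [DecidableEq ι] (p : Matrix ι ι R) :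
    (1 - p).map φ = 1 - p.map φ := by
  ext i j
  by_cases h : i = j <;> simp [h]

/-- A triple `(p, q, a)` together with the elementary triple on `1 - p` is isomorphic to a
triple `(1, q ⊕ (1 - p), a')`. -/
theorem Triple.morIso_one [DecidableEq ι] (x : Triple φ ι) :
    MorIso φ (Matrix.fromBlocks x.p 0 0 (1 - x.p)) (Matrix.fromBlocks x.q 0 0 (1 - x.p))
      (Matrix.fromBlocks x.a 0 0 ((1 - x.p).map φ))
      (1 : Matrix ι ι R) (Matrix.fromBlocks x.q 0 0 (1 - x.p))
      (Matrix.fromRows x.a ((1 - x.p).map φ)) := by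
  have h2 : (1 - x.p) * x.p = 0 := by rw [sub_mul, one_mul, x.hp, sub_self]
  have h3 : (1 - x.p) * (1 - x.p) = 1 - x.p := by rw [mul_sub, mul_one, h2, sub_zero]
  have h3' : (1 - x.p).map φ * (1 - x.p).map φ = (1 - x.p).map φ := by rw [← Matrix.map_mul, h3]
  have h2' : (1 - x.p).map φ * x.p.map φ = 0 := by rw [← Matrix.map_mul, h2]; simp
  have h4 : x.a * (1 - x.p).map φ = 0 := by
    rw [map_one_sub, mul_sub, mul_one, x.isInvMor_a.1.2, sub_self]
  refine ⟨_, _, isInvMor_fromCols_compl x.hp,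
    (IsInvMor.refl x.hq).fromBlocks (.refl h3), ?_⟩
  have hcols : (Matrix.fromCols x.p (1 - x.p)).map φ
      = Matrix.fromCols (x.p.map φ) ((1 - x.p).map φ) := by
    ext i (j | j) <;> rfl
  simp [hcols, Matrix.fromBlocks_map, Matrix.fromBlocks_multiply,
    h2', h3', h4, x.isInvMor_a.1.1, x.isInvMor_a.1.2]

/-- The rectangular matrix of `Triple.morIso_one` is an invertible morphism from `1` to
`q ⊕ (1 - p)`. -/
theorem Triple.isInvMor_one [DecidableEq ι] (x : Triple φ ι) :
    IsInvMor (1 : Matrix ι ι S) ((Matrix.fromBlocks x.q 0 0 (1 - x.p)).map φ)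
      (Matrix.fromRows x.a ((1 - x.p).map φ)) := by
  have h2 : (1 - x.p) * x.p = 0 := by rw [sub_mul, one_mul, x.hp, sub_self]
  have h3 : (1 - x.p) * (1 - x.p) = 1 - x.p := by rw [mul_sub, mul_one, h2, sub_zero]
  have h3' : (1 - x.p).map φ * (1 - x.p).map φ = (1 - x.p).map φ := by rw [← Matrix.map_mul, h3]
  have h4 : x.a * (1 - x.p).map φ = 0 := by
    rw [map_one_sub, mul_sub, mul_one, x.isInvMor_a.1.2, sub_self]
  have h5 : (1 - x.p).map φ * x.inv.a = 0 := by
    rw [map_one_sub, sub_mul, one_mul, sub_eq_zero]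
    exact x.inv.isInvMor_a.1.1.symm
  have h6 : x.inv.a * x.q.map φ = x.inv.a := x.inv.isInvMor_a.1.2
  refine ⟨⟨?_, Matrix.mul_one _⟩, Matrix.fromCols x.inv.a ((1 - x.p).map φ),
    ⟨Matrix.one_mul _, ?_⟩, ?_, ?_⟩
  · simp [Matrix.fromBlocks_map, Matrix.fromBlocks_mul_fromRows, h3', x.isInvMor_a.1.1]
  · simp [Matrix.fromBlocks_map, Matrix.fromCols_mul_fromBlocks, h3', h6]
  · simp [Matrix.fromBlocks_map, h3', h4, h5, x.a_mul_inv]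
  · rw [Matrix.fromCols_mul_fromRows, x.inv_mul_a, h3', map_one_sub, add_sub_cancel]

/-- A triple of the form `(p, p, p)`. -/
def Triple.ofProj (φ : R →⋆ₐ[ℂ] S) {p : Matrix ι ι R} (hp : IsStarProjection p) : Triple φ ι where
  p := p
  q := p
  a := p.map φ
  isStarProjection_p := hp
  isStarProjection_q := hp
  isInvMor_a := isInvMor_map (.refl hp.isIdempotentElem)

theorem Triple.ofProj_elementary {p : Matrix ι ι R} (hp : IsStarProjection p) :
    (Triple.ofProj φ hp).Elementary :=
  ⟨rfl, JoinedIn.refl (isInvMor_map (.refl hp.isIdempotentElem))⟩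

/-- The triple `(1 - p, 1 - p, 1 - p)` attached to `(p, q, a)`. -/
abbrev Triple.compl [DecidableEq ι] (x : Triple φ ι) : Triple φ ι :=
  .ofProj φ x.isStarProjection_p.one_sub

/-- The element of `Γ` given by a triple whose rows and columns are indexed by any finite type. -/
noncomputable def Triple.toGam (x : Triple φ ι) : Gam φ :=
  ⟨Fintype.card ι, x.reindex (Fintype.equivFin ι)⟩

theorem Triple.toGam_iso (x : Triple φ ι) : Triple.Iso x.toGam.2 x :=
  (Triple.iso_reindex _ _).symm

theorem Triple.Elementary.toGam {x : Triple φ ι} (hx : x.Elementary) : x.toGam.Elementary :=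
  hx.reindex _

theorem K0.mk_eq_of_iso {x y : Gam φ} (h : Triple.Iso x.2 y.2) : K0.mk x = K0.mk y :=
  Quotient.sound (Gam.Iso.equivalent h)

theorem K0.mk_eq_zero_of_elementary {x : Gam φ} (h : x.Elementary) : K0.mk x = 0 :=
  Quotient.sound h.equivalent_zero

/-- The sum of `(p, q, a)` and the elementary triple `(1 - p, 1 - p, 1 - p)`. -/
def Gam.addCompl (x : Gam φ) : Gam φ := x.add ⟨x.1, x.2.compl⟩

theorem Gam.mk_addCompl (x : Gam φ) : K0.mk x.addCompl = K0.mk x := by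
  have h : K0.mk (φ := φ) ⟨x.1, x.2.compl⟩ = 0 :=
    K0.mk_eq_zero_of_elementary (Triple.ofProj_elementary x.2.isStarProjection_p.one_sub)
  calc K0.mk x.addCompl = K0.mk x + K0.mk (φ := φ) ⟨x.1, x.2.compl⟩ := K0.mk_add _ _
    _ = K0.mk x := by rw [h, add_zero]

theorem Gam.addCompl_morIso (x : Gam φ) :
    MorIso φ x.addCompl.2.p x.addCompl.2.q x.addCompl.2.a
      (1 : Matrix (Fin x.1) (Fin x.1) R) (Matrix.fromBlocks x.2.q 0 0 (1 - x.2.p))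
      (Matrix.fromRows x.2.a ((1 - x.2.p).map φ)) :=
  MorIso.trans (Gam.add_iso_sum x ⟨x.1, x.2.compl⟩) x.2.morIso_one

end MorIso

/-! ### Paths of invertible matrices over a C⋆-algebra -/

section MatrixUnits

open scoped Matrix.Norms.Operator

variable {S : Type*} [CStarAlgebra S] {ι : Type} [Fintype ι] [DecidableEq ι]

/-- Completeness for the uniform structure of the operator norm, which agrees with the entrywise
one. -/
theorem completeSpace_matrix :
    @CompleteSpace (Matrix ι ι S) PseudoMetricSpace.toUniformSpace :=
  inferInstanceAs (CompleteSpace (ι → ι → S))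

theorem matrix_joinedIn_isUnit_mul {v w : Matrix ι ι S}
    (hv : JoinedIn {w : Matrix ι ι S | IsUnit w} 1 v)
    (hw : JoinedIn {w : Matrix ι ι S | IsUnit w} 1 w) :
    JoinedIn {w : Matrix ι ι S | IsUnit w} 1 (v * w) :=
  joinedIn_isUnit_mul hv hw

theorem matrix_exists_joinedIn_mul_eq_one {u : Matrix ι ι S}
    (hu : JoinedIn {w : Matrix ι ι S | IsUnit w} 1 u) :
    ∃ v : Matrix ι ι S, JoinedIn {w : Matrix ι ι S | IsUnit w} 1 v ∧ u * v = 1 := by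
  have := completeSpace_matrix (S := S) (ι := ι)
  obtain ⟨u, rfl⟩ : IsUnit u := hu.target_mem
  exact ⟨_, joinedIn_isUnit_inv u hu, u.mul_inv⟩

/-- In a factorization `a ⊕ w = g u`, an invertible block `w` in the path component of `1` can be
absorbed into `u`. -/
theorem exists_joinedIn_fromBlocks_one {κ μ : Type} [Fintype κ] [Fintype μ] [DecidableEq μ]
    {a : Matrix κ ι S} {w : Matrix μ μ S} (hw : JoinedIn {w : Matrix μ μ S | IsUnit w} 1 w)
    {g : Matrix (κ ⊕ μ) (ι ⊕ μ) S} {u : Matrix (ι ⊕ μ) (ι ⊕ μ) S}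
    (hu : JoinedIn {w : Matrix (ι ⊕ μ) (ι ⊕ μ) S | IsUnit w} 1 u)
    (h : Matrix.fromBlocks a 0 0 w = g * u) :
    ∃ u' : Matrix (ι ⊕ μ) (ι ⊕ μ) S,
      JoinedIn {w : Matrix (ι ⊕ μ) (ι ⊕ μ) S | IsUnit w} 1 u' ∧
      Matrix.fromBlocks a 0 0 1 = g * u' := by
  have hw1 : JoinedIn {w : Matrix (ι ⊕ μ) (ι ⊕ μ) S | IsUnit w} 1
      (Matrix.fromBlocks 1 0 0 w) := by
    have h := hw.map (f := fun w => Matrix.fromBlocks (1 : Matrix ι ι S) 0 0 w)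
      (Continuous.matrix_fromBlocks continuous_const continuous_const continuous_const
        continuous_id)
    rw [Matrix.fromBlocks_one] at h
    refine h.mono ?_
    rintro _ ⟨_, ⟨v, rfl⟩, rfl⟩
    exact ⟨⟨Matrix.fromBlocks 1 0 0 ↑v, Matrix.fromBlocks 1 0 0 ↑v⁻¹,
      by simp [Matrix.fromBlocks_multiply], by simp [Matrix.fromBlocks_multiply]⟩, rfl⟩
  obtain ⟨v, hv, hwv⟩ := matrix_exists_joinedIn_mul_eq_one hw1
  refine ⟨u * v, matrix_joinedIn_isUnit_mul hu hv, ?_⟩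
  have hsplit : Matrix.fromBlocks a 0 0 w =
      Matrix.fromBlocks a 0 0 (1 : Matrix μ μ S) *
        Matrix.fromBlocks (1 : Matrix ι ι S) 0 0 w := by
    simp [Matrix.fromBlocks_multiply]
  rw [← Matrix.mul_assoc, ← h, hsplit, Matrix.mul_assoc, hwv, Matrix.mul_one]

/-- `exists_lift_of_joinedIn` for matrix algebras over C⋆-algebras. -/
theorem matrix_exists_lift_of_joinedIn {P T : Type*} [CStarAlgebra P] [CStarAlgebra T]
    (φ : P →⋆ₐ[ℂ] S) (σ : P →⋆ₐ[ℂ] T) (τ : S →⋆ₐ[ℂ] T) (hτφ : ∀ r, τ (φ r) = σ r)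
    (hsurj : Function.Surjective σ) (u : Matrix ι ι S)
    (hu : JoinedIn {w : Matrix ι ι S | IsUnit w} 1 u) :
    ∃ (h h' : Matrix ι ι P) (v : Matrix ι ι S), h * h' = 1 ∧ h' * h = 1 ∧ u = h.map φ * v ∧
      JoinedIn {w : Matrix ι ι S | w.map τ = 1 ∧ ∃ w', w'.map τ = 1 ∧ w * w' = 1 ∧ w' * w = 1}
        1 v := by
  have := completeSpace_matrix (S := S) (ι := ι)
  have := completeSpace_matrix (S := P) (ι := ι)
  have := completeSpace_matrix (S := T) (ι := ι)
  obtain ⟨u, rfl⟩ : IsUnit u := hu.target_mem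
  have hφ : Continuous φ := by
    open scoped CStarAlgebra in exact map_continuous φ
  have hτ : Continuous τ := by
    open scoped CStarAlgebra in exact map_continuous τ
  obtain ⟨h, hh⟩ := exists_lift_of_joinedIn (φ : P →ₐ[ℂ] S).mapMatrix
    (σ : P →ₐ[ℂ] T).mapMatrix (τ : S →ₐ[ℂ] T).mapMatrix
    (Continuous.matrix_map continuous_id hφ) (Continuous.matrix_map continuous_id hτ)
    (fun r => by ext i j; exact hτφ _)
    (fun M => ⟨M.map (Function.surjInv hsurj), by
      ext i j; exact Function.surjInv_eq hsurj _⟩) u hu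
  refine ⟨h, ↑h⁻¹, _, h.mul_inv, h.inv_mul, ?_,
    (hh.map Units.continuous_val).mono ?_⟩
  · set h0 := Units.map (((φ : P →ₐ[ℂ] S).mapMatrix : Matrix ι ι P →ₐ[ℂ] Matrix ι ι S) :
      Matrix ι ι P →* Matrix ι ι S) h
    have : (h : Matrix ι ι P).map φ = h0 := rfl
    rw [this, ← Units.val_mul, mul_inv_cancel_left]
  · rintro _ ⟨w, hw, rfl⟩
    have key : ∀ w : (Matrix ι ι S)ˣ, w ∈ (Units.map (((τ : S →ₐ[ℂ] T).mapMatrix :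
        Matrix ι ι S →ₐ[ℂ] Matrix ι ι T) : Matrix ι ι S →* Matrix ι ι T)).ker →
        (w : Matrix ι ι S).map τ = 1 := fun w hw => congrArg Units.val hw
    exact ⟨key w hw, ↑w⁻¹, key _ (Subgroup.inv_mem _ hw), w.mul_inv, w.inv_mul⟩

end MatrixUnits

/-! ### Triples with vanishing class -/

section Kernel

variable {R : Type*} {S : Type*} [Ring R] [StarRing R] [Algebra ℂ R] [CStarAlgebra S]
  {φ : R →⋆ₐ[ℂ] S} {ι κ : Type} [Fintype ι] [Fintype κ]

/-- For an elementary triple `(p, p, a)`, the sum with `(1 - p, 1 - p, 1 - p)` is isomorphic to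
`(1, 1, a + (1 - p))`, and `a + (1 - p)` lies in the path component of `1`. -/
theorem Triple.Elementary.morIso_one [DecidableEq ι] {x : Triple φ ι} (hx : x.Elementary) :
    ∃ w : Matrix ι ι S, JoinedIn {w : Matrix ι ι S | IsUnit w} 1 w ∧
      MorIso φ (x.sum x.compl).p (x.sum x.compl).q (x.sum x.compl).a 1 1 w := by
  obtain ⟨hpq, hx⟩ := hx
  have h2 : (1 - x.p) * x.p = 0 := by rw [sub_mul, one_mul, x.hp, sub_self]
  have h1 : x.p * (1 - x.p) = 0 := by rw [mul_sub, mul_one, x.hp, sub_self]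
  have h3 : (1 - x.p) * (1 - x.p) = 1 - x.p := by rw [mul_sub, mul_one, h2, sub_zero]
  have h1' : x.p.map φ * (1 - x.p).map φ = 0 := by rw [← Matrix.map_mul, h1]; simp
  have h2' : (1 - x.p).map φ * x.p.map φ = 0 := by rw [← Matrix.map_mul, h2]; simp
  have h3' : (1 - x.p).map φ * (1 - x.p).map φ = (1 - x.p).map φ := by rw [← Matrix.map_mul, h3]
  have hsum : x.p.map φ + (1 - x.p).map φ = 1 := by rw [map_one_sub, add_sub_cancel]
  have hl : ∀ w, IsMor (x.p.map φ) (x.p.map φ) w → (1 - x.p).map φ * w = 0 := fun w hw => by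
    rw [← hw.1, ← mul_assoc, h2', zero_mul]
  have hr : ∀ w, IsMor (x.p.map φ) (x.p.map φ) w → w * (1 - x.p).map φ = 0 := fun w hw => by
    rw [← hw.2, mul_assoc, h1', mul_zero]
  have hxa : IsMor (x.p.map φ) (x.p.map φ) x.a := hx.target_mem.1
  refine ⟨x.a + (1 - x.p).map φ, ?_, Matrix.fromCols x.p (1 - x.p),
    Matrix.fromCols x.p (1 - x.p), isInvMor_fromCols_compl x.hp, ?_, ?_⟩
  · have h := hx.map (f := fun w => w + (1 - x.p).map φ) (by fun_prop)
    rw [hsum] at h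
    refine h.mono ?_
    rintro _ ⟨w, ⟨hw, b, hb, hwb, hbw⟩, rfl⟩
    refine ⟨⟨w + (1 - x.p).map φ, b + (1 - x.p).map φ, ?_, ?_⟩, rfl⟩
    · rw [mul_add, add_mul, add_mul, hwb, hl b hb, hr w hw, h3', add_zero, zero_add, hsum]
    · rw [mul_add, add_mul, add_mul, hbw, hl w hw, hr b hb, h3', add_zero, zero_add, hsum]
  · have := isInvMor_fromCols_compl x.hp
    simpa [Triple.sum, Triple.ofProj, ← hpq] using this
  · have hcols : (Matrix.fromCols x.p (1 - x.p)).map φ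
        = Matrix.fromCols (x.p.map φ) ((1 - x.p).map φ) := by
      ext i (j | j) <;> rfl
    rw [hcols, Matrix.mul_fromCols, add_mul, add_mul, hxa.2, h2', hr _ hxa, h3', add_zero, zero_add]
    simp [Triple.sum, Triple.ofProj, Matrix.fromCols_mul_fromBlocks, h3', hxa.1]

/-- Conjugating an elementary triple by an isomorphism `c : 1 → p` over `R` gives an invertible
matrix in the path component of `1`. -/
theorem Triple.Elementary.conj [DecidableEq κ] {x : Triple φ ι} (hx : x.Elementary)
    {c : Matrix ι κ R} (hc : IsInvMor 1 x.p c) :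
    ∃ u : Matrix κ κ S, JoinedIn {w : Matrix κ κ S | IsUnit w} 1 u ∧
      c.map φ * u = x.a * c.map φ := by
  obtain ⟨-, hx⟩ := hx
  have hc1 := isInvMor_map (φ := φ) hc
  obtain ⟨b, hb, hcb, hbc⟩ := hc1.exists_inv
  have h1 : (1 : Matrix κ κ R).map φ = 1 := by
    rw [Matrix.map_one _ (map_zero φ) (map_one φ)]
  rw [h1] at hc1 hb hbc
  refine ⟨b * x.a * c.map φ, ?_, ?_⟩
  · have h := hx.map (f := fun w => b * w * c.map φ) (by fun_prop)
    rw [hb.1.2, hbc] at h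
    refine h.mono ?_
    rintro _ ⟨w, hw, rfl⟩
    refine isInvMor_one_iff.1 ?_
    change IsInvMor 1 1 (b * w * c.map φ)
    rw [Matrix.mul_assoc]
    exact (hc1.comp hw).comp hb
  · rw [← Matrix.mul_assoc, ← Matrix.mul_assoc, hcb, hx.target_mem.1.1]

/-- If the class of a triple isomorphic to `(1, Q, a)` vanishes, then after adding some identity
`1ₖ` the morphism `a` becomes the product of an isomorphism over `R` and an invertible element in
the path component of the identity. -/
theorem exists_of_mk_eq_zero [DecidableEq ι] (y : Gam φ) (hy : K0.mk y = 0) {Q : Matrix κ κ R}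
    {a : Matrix κ ι S} (ha : IsMor 1 (Q.map φ) a)
    (h : MorIso φ y.2.p y.2.q y.2.a 1 Q a) :
    ∃ (k : ℕ) (g : Matrix (κ ⊕ Fin k) (ι ⊕ Fin k) R) (u : Matrix (ι ⊕ Fin k) (ι ⊕ Fin k) S),
      IsInvMor 1 (Matrix.fromBlocks Q 0 0 1) g ∧
      JoinedIn {w : Matrix (ι ⊕ Fin k) (ι ⊕ Fin k) S | IsUnit w} 1 u ∧
      Matrix.fromBlocks a 0 0 1 = g.map φ * u := by
  obtain ⟨e, f, he, hf, hi⟩ : Gam.Equivalent y (Gam.zero φ) := Quotient.exact hy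
  have h1 : ∀ {α : Type} [DecidableEq α], (1 : Matrix α α R).map φ = 1 := fun {α} _ => by
    rw [Matrix.map_one _ (map_zero φ) (map_one φ)]
  obtain ⟨w, hw, hew⟩ := Triple.Elementary.morIso_one he
  set z : Triple φ _ := ((Gam.zero φ).add f).2.sum e.2.compl
  have hz : z.Elementary := Triple.Elementary.sum (Gam.zero_elementary.add hf)
    (Triple.ofProj_elementary _)
  have hyz : Triple.Iso (y.2.sum (e.2.sum e.2.compl)) z :=
    ((Triple.sum_assoc_iso _ _ _).symm.trans
      ((Gam.add_iso_sum y e).symm.sum (.refl e.2.compl))).trans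
      (Triple.Iso.sum hi (.refl e.2.compl))
  have hy1 : MorIso φ (y.2.sum (e.2.sum e.2.compl)).p (y.2.sum (e.2.sum e.2.compl)).q
      (y.2.sum (e.2.sum e.2.compl)).a 1 (Matrix.fromBlocks Q 0 0 1)
      (Matrix.fromBlocks a 0 0 w) := by
    have := h.fromBlocks hew
    rwa [Matrix.fromBlocks_one] at this
  have haw : IsMor ((1 : Matrix (ι ⊕ Fin e.1) (ι ⊕ Fin e.1) R).map φ)
      ((Matrix.fromBlocks Q 0 0 1).map φ) (Matrix.fromBlocks a 0 0 w) := by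
    rw [h1]
    refine ⟨?_, Matrix.mul_one _⟩
    simp [Matrix.fromBlocks_map, Matrix.fromBlocks_multiply, ha.1]
  obtain ⟨c, d, hc, hd, hcd⟩ := (hy1.symm (Triple.isInvMor_a _).1 haw).trans hyz
  obtain ⟨u, hu, hcu⟩ := hz.conj hc
  rw [← hz.1] at hd
  obtain ⟨d', hd', -, hdd⟩ := hd.exists_inv
  have hprod : Matrix.fromBlocks a 0 0 w = (d' * c).map φ * u := by
    rw [Matrix.map_mul, Matrix.mul_assoc, hcu, ← hcd, ← Matrix.mul_assoc, ← Matrix.map_mul, hdd,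
      haw.1]
  obtain ⟨u', hu', hu''⟩ := exists_joinedIn_fromBlocks_one hw hu hprod
  exact ⟨e.1, d' * c, u', hc.comp hd', hu', hu''⟩

/-- The converse of `exists_of_mk_eq_zero`. -/
theorem mk_eq_zero_of_eq_mul [DecidableEq ι] (y : Gam φ) {Q : Matrix κ κ R} {a : Matrix κ ι S}
    (h : MorIso φ y.2.p y.2.q y.2.a 1 Q a) {k : ℕ}
    {g : Matrix (κ ⊕ Fin k) (ι ⊕ Fin k) R} {u : Matrix (ι ⊕ Fin k) (ι ⊕ Fin k) S}
    (hg : IsInvMor 1 (Matrix.fromBlocks Q 0 0 1) g)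
    (hu : JoinedIn {w : Matrix (ι ⊕ Fin k) (ι ⊕ Fin k) S | IsUnit w} 1 u)
    (hgu : Matrix.fromBlocks a 0 0 1 = g.map φ * u) : K0.mk y = 0 := by
  have h1 : ∀ {α : Type} [DecidableEq α], (1 : Matrix α α R).map φ = 1 := fun {α} _ => by
    rw [Matrix.map_one _ (map_zero φ) (map_one φ)]
  have hone : IsStarProjection (1 : Matrix (Fin k) (Fin k) R) := .one _
  have hone' : IsStarProjection (1 : Matrix (ι ⊕ Fin k) (ι ⊕ Fin k) R) := .one _
  let z : Triple φ (ι ⊕ Fin k) :=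
    { p := 1, q := 1, a := u, isStarProjection_p := hone', isStarProjection_q := hone'
      isInvMor_a := by rw [h1, isInvMor_one_iff]; exact hu.target_mem }
  have hz : z.Elementary := by
    refine ⟨rfl, ?_⟩
    change JoinedIn {w | IsInvMor ((1 : Matrix (ι ⊕ Fin k) (ι ⊕ Fin k) R).map φ)
      ((1 : Matrix (ι ⊕ Fin k) (ι ⊕ Fin k) R).map φ) w} _ u
    simp only [h1, isInvMor_one_iff]
    change JoinedIn _ ((1 : Matrix (ι ⊕ Fin k) (ι ⊕ Fin k) R).map φ) _
    rw [h1]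
    exact hu
  let t : Triple φ (Fin k) := .ofProj φ hone
  have hyt : Triple.Iso (y.2.sum t) z := by
    have h2 : MorIso φ t.p t.q t.a (1 : Matrix (Fin k) (Fin k) R) 1 1 :=
      ⟨1, 1, .refl (one_mul _), .refl (one_mul _), by simp only [t, Triple.ofProj, h1]⟩
    have h3 := h.fromBlocks h2
    rw [Matrix.fromBlocks_one] at h3
    obtain ⟨g', hg', -, hgg⟩ := hg.exists_inv
    refine MorIso.trans h3 ⟨1, g', .refl (one_mul _), hg', ?_⟩
    rw [hgu, ← Matrix.mul_assoc, ← Matrix.map_mul, hgg, h1, Matrix.one_mul, Matrix.mul_one]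
  have ht : K0.mk (φ := φ) ⟨k, t⟩ = 0 :=
    K0.mk_eq_zero_of_elementary (Triple.ofProj_elementary hone)
  calc K0.mk y = K0.mk y + K0.mk (φ := φ) ⟨k, t⟩ := by rw [ht, add_zero]
    _ = K0.mk (y.add ⟨k, t⟩) := (K0.mk_add _ _).symm
    _ = K0.mk z.toGam := K0.mk_eq_of_iso
        (((Gam.add_iso_sum y ⟨k, t⟩).trans hyt).trans z.toGam_iso.symm)
    _ = 0 := K0.mk_eq_zero_of_elementary hz.toGam

end Kernel

/-! ### Morphisms over a subring -/

section Descent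

theorem map_injective_matrix {R S : Type*} {f : R → S} (hf : Function.Injective f)
    {ι κ : Type} {M N : Matrix ι κ R} (h : M.map f = N.map f) : M = N :=
  Matrix.map_injective hf h

/-- An invertible morphism whose entries, and those of its inverse, come from a subring is an
invertible morphism over the subring. -/
theorem IsInvMor.of_map {R S : Type*} [Ring R] [Ring S] {f : R →+* S}
    (hf : Function.Injective f) {ι κ : Type} [Fintype ι] [Fintype κ] {p : Matrix ι ι R}
    {q : Matrix κ κ R} {a : Matrix κ ι R} {b : Matrix ι κ R}
    (ha : IsMor (p.map f) (q.map f) (a.map f)) (hb : IsMor (q.map f) (p.map f) (b.map f))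
    (hab : a.map f * b.map f = q.map f) (hba : b.map f * a.map f = p.map f) : IsInvMor p q a := by
  obtain ⟨h1, h2⟩ := ha
  obtain ⟨h3, h4⟩ := hb
  rw [← Matrix.map_mul] at h1 h2 h3 h4 hab hba
  have inj := @map_injective_matrix R S f hf
  exact ⟨⟨inj h1, inj h2⟩, b, ⟨inj h3, inj h4⟩, inj hab, inj hba⟩

end Descent

/-! ### Replacing idempotents by projections -/

section Representatives

variable {R : Type*} {S : Type*} [CStarAlgebra R] [CStarAlgebra S]
  {φ : R →⋆ₐ[ℂ] S} {ι κ : Type} [Fintype ι] [Fintype κ]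

theorem isInvMor_fromCols_zero {R : Type*} [Ring R] {p : Matrix ι ι R} (hp : p * p = p) :
    IsInvMor (Matrix.fromBlocks p 0 0 (0 : Matrix κ κ R)) p (Matrix.fromCols p 0) := by
  refine ⟨⟨?_, ?_⟩, Matrix.fromRows p 0, ⟨?_, ?_⟩, ?_, ?_⟩
  · simp [Matrix.mul_fromCols, hp]
  · simp [Matrix.fromCols_mul_fromBlocks, hp]
  · simp [Matrix.fromBlocks_mul_fromRows, hp]
  · simp [Matrix.fromRows_mul, hp]
  · simp [Matrix.fromCols_mul_fromRows, hp]
  · rw [Matrix.fromRows_mul_fromCols, hp, Matrix.mul_zero, Matrix.zero_mul, Matrix.mul_zero]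

theorem isInvMor_zero_fromCols {R : Type*} [Ring R] {p : Matrix κ κ R} (hp : p * p = p) :
    IsInvMor (Matrix.fromBlocks (0 : Matrix ι ι R) 0 0 p) p (Matrix.fromCols 0 p) := by
  refine ⟨⟨?_, ?_⟩, Matrix.fromRows 0 p, ⟨?_, ?_⟩, ?_, ?_⟩
  · simp [Matrix.mul_fromCols, hp]
  · simp [Matrix.fromCols_mul_fromBlocks, hp]
  · simp [Matrix.fromBlocks_mul_fromRows, hp]
  · simp [Matrix.fromRows_mul, hp]
  · simp [Matrix.fromCols_mul_fromRows, hp]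
  · rw [Matrix.fromRows_mul_fromCols, hp, Matrix.mul_zero, Matrix.zero_mul, Matrix.mul_zero]

/-- Every invertible morphism between idempotents is isomorphic to a triple. -/
theorem exists_gam_morIso {p : Matrix ι ι R} {q : Matrix κ κ R} {a : Matrix κ ι S}
    (hp : p * p = p) (hq : q * q = q) (ha : IsInvMor (p.map φ) (q.map φ) a) :
    ∃ x : Gam φ, MorIso φ x.2.p x.2.q x.2.a p q a := by
  obtain ⟨p₀, hp₀, hc⟩ := exists_isStarProjection_isInvMor hp
  obtain ⟨q₀, hq₀, hd⟩ := exists_isStarProjection_isInvMor hq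
  obtain ⟨d', hd', hdd, -⟩ := hd.exists_inv
  have hsp : IsStarProjection (Matrix.fromBlocks p₀ 0 0 (0 : Matrix κ κ R)) := by
    refine ⟨?_, ?_⟩
    · simp [IsIdempotentElem, Matrix.fromBlocks_multiply, hc.source_mul_self]
    · have h1 := hp₀.isSelfAdjoint.star_eq
      rw [Matrix.star_eq_conjTranspose] at h1
      simp [IsSelfAdjoint, Matrix.star_eq_conjTranspose, Matrix.fromBlocks_conjTranspose, h1]
  have hsq : IsStarProjection (Matrix.fromBlocks (0 : Matrix ι ι R) 0 0 q₀) := by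
    refine ⟨?_, ?_⟩
    · simp [IsIdempotentElem, Matrix.fromBlocks_multiply, hd.source_mul_self]
    · have h1 := hq₀.isSelfAdjoint.star_eq
      rw [Matrix.star_eq_conjTranspose] at h1
      simp [IsSelfAdjoint, Matrix.star_eq_conjTranspose, Matrix.fromBlocks_conjTranspose, h1]
  have hP := (isInvMor_fromCols_zero (κ := κ) hc.source_mul_self).comp hc
  have hQ := (isInvMor_zero_fromCols (ι := ι) hd.source_mul_self).comp hd
  obtain ⟨e, he, hee, -⟩ := hQ.exists_inv
  let z : Triple φ (ι ⊕ κ) :=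
    { p := Matrix.fromBlocks p₀ 0 0 0
      q := Matrix.fromBlocks 0 0 0 q₀
      a := e.map φ * a * (p₀ * Matrix.fromCols p₀ 0).map φ
      isStarProjection_p := hsp
      isStarProjection_q := hsq
      isInvMor_a := by
        rw [Matrix.mul_assoc]
        exact ((isInvMor_map hP).comp ha).comp (isInvMor_map he) }
  refine ⟨z.toGam, MorIso.trans z.toGam_iso ⟨_, _, hP, hQ, ?_⟩⟩
  change _ * (e.map φ * a * _) = _
  rw [← Matrix.mul_assoc, ← Matrix.mul_assoc, ← Matrix.map_mul, hee, ha.1.1]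

end Representatives

/-! ### Lifting an isomorphism through elementary matrices -/

section Swap

variable {R T : Type*} [Ring R] [Ring T] {ι κ : Type} [Fintype ι] [Fintype κ]
  [DecidableEq ι] [DecidableEq κ]

/-- If `σ(Q)` is isomorphic to `1` through `α` and `β`, then `Q` is isomorphic to an idempotent
`Q'` that lifts `1 ⊕ 0`.  The isomorphism is the restriction to `0 ⊕ Q` of the product of
elementary matrices `E₁₂(X) E₂₁(-Y) E₁₂(X)`, where `X` and `Y` lift `β` and `α`. -/
theorem exists_isInvMor_lift (σ : R →+* T) (hσ : Function.Surjective σ) {Q : Matrix κ κ R}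
    (hQ : Q * Q = Q) {α : Matrix κ ι T} {β : Matrix ι κ T}
    (hα : Q.map σ * α = α) (hβ : β * Q.map σ = β) (hαβ : α * β = Q.map σ) (hβα : β * α = 1) :
    ∃ (Q' : Matrix (ι ⊕ κ) (ι ⊕ κ) R) (d : Matrix (ι ⊕ κ) κ R) (d' : Matrix κ (ι ⊕ κ) R),
      IsMor Q Q' d ∧ IsMor Q' Q d' ∧ d * d' = Q' ∧ d' * d = Q ∧
      d.map σ = Matrix.fromRows β 0 ∧ d'.map σ = Matrix.fromCols α 0 ∧
      Q'.map σ = Matrix.fromBlocks 1 0 0 0 := by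
  obtain ⟨X, hX⟩ : ∃ X : Matrix ι κ R, X.map σ = β :=
    ⟨β.map (Function.surjInv hσ), by ext i j; exact Function.surjInv_eq hσ _⟩
  obtain ⟨Y, hY⟩ : ∃ Y : Matrix κ ι R, Y.map σ = α :=
    ⟨α.map (Function.surjInv hσ), by ext i j; exact Function.surjInv_eq hσ _⟩
  let U : Matrix ι κ R → Matrix (ι ⊕ κ) (ι ⊕ κ) R := fun X => Matrix.fromBlocks 1 X 0 1
  let L : Matrix κ ι R → Matrix (ι ⊕ κ) (ι ⊕ κ) R := fun Y => Matrix.fromBlocks 1 0 Y 1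
  have hU : U (-X) * U X = 1 := by
    simp [U, Matrix.fromBlocks_multiply]
  have hL : L Y * L (-Y) = 1 := by
    simp [L, Matrix.fromBlocks_multiply]
  set V := U X * L (-Y) * U X with hVdef
  set V' := U (-X) * L Y * U (-X) with hV'def
  have hV : V' * V = 1 := by
    calc V' * V = U (-X) * (L Y * (U (-X) * U X) * L (-Y)) * U X := by
          simp only [hVdef, hV'def, Matrix.mul_assoc]
      _ = 1 := by rw [hU, Matrix.mul_one, hL, Matrix.mul_one, hU]
  have hfr : Matrix.fromRows (0 : Matrix ι κ R) Q * Q = Matrix.fromRows 0 Q := by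
    rw [Matrix.fromRows_mul, hQ, Matrix.zero_mul]
  have hfc : Q * Matrix.fromCols (0 : Matrix κ ι R) Q = Matrix.fromCols 0 Q := by
    rw [Matrix.mul_fromCols, hQ, Matrix.mul_zero]
  set d : Matrix (ι ⊕ κ) κ R := V * Matrix.fromRows (0 : Matrix ι κ R) Q with hd_def
  set d' : Matrix κ (ι ⊕ κ) R := Matrix.fromCols (0 : Matrix κ ι R) Q * V' with hd'_def
  have hdd : d' * d = Q := by
    rw [hd_def, hd'_def, Matrix.mul_assoc, ← Matrix.mul_assoc V', hV, Matrix.one_mul,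
      Matrix.fromCols_mul_fromRows, Matrix.zero_mul, zero_add, hQ]
  have hdQ : d * Q = d := by rw [hd_def, Matrix.mul_assoc, hfr]
  have hQd' : Q * d' = d' := by rw [hd'_def, ← Matrix.mul_assoc, hfc]
  have hUσ : ∀ X : Matrix ι κ R, (U X).map σ = Matrix.fromBlocks 1 (X.map σ) 0 1 := fun X => by
    simp [U, Matrix.fromBlocks_map]
  have hLσ : ∀ Y : Matrix κ ι R, (L Y).map σ = Matrix.fromBlocks 1 0 (Y.map σ) 1 := fun Y => by
    simp [L, Matrix.fromBlocks_map]
  have hnX : (-X).map σ = -β := by rw [← hX]; ext; simp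
  have hnY : (-Y).map σ = -α := by rw [← hY]; ext; simp
  have hff : Q.map σ * Q.map σ = Q.map σ := by rw [← Matrix.map_mul, hQ]
  have hd : d.map σ = Matrix.fromRows β 0 := by
    have h0 : (Matrix.fromRows (0 : Matrix ι κ R) Q).map σ = Matrix.fromRows 0 (Q.map σ) := by
      ext (i | i) j <;> simp
    rw [hd_def, Matrix.map_mul, h0, hVdef, Matrix.map_mul, Matrix.map_mul, hUσ, hLσ, hX, hnY]
    simp [Matrix.fromBlocks_multiply, Matrix.fromBlocks_mul_fromRows, hβα, add_mul, hβ, hαβ, hff]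
  have hd' : d'.map σ = Matrix.fromCols α 0 := by
    have h0 : (Matrix.fromCols (0 : Matrix κ ι R) Q).map σ = Matrix.fromCols 0 (Q.map σ) := by
      ext i (j | j) <;> simp
    rw [hd'_def, Matrix.map_mul, h0, hV'def, Matrix.map_mul, Matrix.map_mul, hUσ, hLσ, hY, hnX]
    simp [Matrix.fromBlocks_multiply, Matrix.fromCols_mul_fromBlocks, hβα, mul_add, hα, hαβ, hff]
  refine ⟨d * d', d, d', ⟨?_, hdQ⟩, ⟨hQd', ?_⟩, rfl, hdd, hd, hd', ?_⟩
  · rw [Matrix.mul_assoc, hdd, hdQ]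
  · rw [← Matrix.mul_assoc, hdd, hQd']
  · rw [Matrix.map_mul, hd, hd', Matrix.fromRows_mul_fromCols]
    simp [hβα]

end Swap

/-! ### Descent along an excision square -/

section Excision

variable {RA SA RC SC T : Type*} [CStarAlgebra RA] [CStarAlgebra SA] [CStarAlgebra RC]
  [CStarAlgebra SC] [CStarAlgebra T] {φ : RA →⋆ₐ[ℂ] SA} {ψ : RC →⋆ₐ[ℂ] SC}

/-- All entries of the matrix are complex multiples of the unit of `T`. -/
def IsScalar {T : Type*} [CStarAlgebra T] {ι κ : Type} (M : Matrix ι κ T) : Prop :=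
  ∃ Z : Matrix ι κ ℂ, Z.map (algebraMap ℂ T) = M

theorem isScalar_zero {ι κ : Type} : IsScalar (0 : Matrix ι κ T) :=
  ⟨0, by simp⟩

theorem isScalar_one {ι : Type} [DecidableEq ι] : IsScalar (1 : Matrix ι ι T) :=
  ⟨1, by simp⟩

theorem IsScalar.fromRows {ι κ μ : Type} {M : Matrix ι μ T} {N : Matrix κ μ T}
    (hM : IsScalar M) (hN : IsScalar N) : IsScalar (Matrix.fromRows M N) := by
  obtain ⟨Z, rfl⟩ := hM
  obtain ⟨W, rfl⟩ := hN
  exact ⟨Matrix.fromRows Z W, by ext (i | i) j <;> rfl⟩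

theorem IsScalar.fromCols {ι κ μ : Type} {M : Matrix μ ι T} {N : Matrix μ κ T}
    (hM : IsScalar M) (hN : IsScalar N) : IsScalar (Matrix.fromCols M N) := by
  obtain ⟨Z, rfl⟩ := hM
  obtain ⟨W, rfl⟩ := hN
  exact ⟨Matrix.fromCols Z W, by ext i (j | j) <;> rfl⟩

theorem exists_map_eq_of_isScalar {R R' : Type*} {f : R → R'} {σ : R' → T}
    (h : ∀ r, r ∈ Set.range f ↔ σ r ∈ Set.range (algebraMap ℂ T)) {ι κ : Type}
    {M : Matrix ι κ R'} (hM : IsScalar (M.map σ)) : ∃ N : Matrix ι κ R, N.map f = M := by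
  obtain ⟨Z, hZ⟩ := hM
  have : ∀ i j, ∃ r, f r = M i j := fun i j => (h _).2 ⟨Z i j, congrFun (congrFun hZ i) j⟩
  choose N hN using this
  exact ⟨N, by ext i j; exact hN i j⟩

theorem isScalar_map_map {R R' : Type*} {f : R → R'} {σ : R' → T}
    (h : ∀ r, r ∈ Set.range f ↔ σ r ∈ Set.range (algebraMap ℂ T)) {ι κ : Type}
    (M : Matrix ι κ R) : IsScalar ((M.map f).map σ) := by
  have : ∀ i j, ∃ z, algebraMap ℂ T z = σ (f (M i j)) := fun i j => (h _).1 ⟨_, rfl⟩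
  choose Z hZ using this
  exact ⟨Z, by ext i j; exact hZ i j⟩

variable {f : RA →⋆ₐ[ℂ] RC} {g : SA →⋆ₐ[ℂ] SC} {σ : RC →⋆ₐ[ℂ] T} {τ : SC →⋆ₐ[ℂ] T}
  {ι κ : Type} [Fintype ι] [Fintype κ] [DecidableEq ι]

/-- Every isomorphism `a` over `SC` from `1` to an idempotent over `RC` can be moved by an
isomorphism over `RC` to one defined over `RA` and `SA`: move `a` to a lift of the column
`(1, 0)` over `T`. -/
theorem exists_descent_of_isInvMor (hfg : ∀ r, g (φ r) = ψ (f r)) (hτ : ∀ r, τ (ψ r) = σ r)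
    (hσ : Function.Surjective σ) (hf : Function.Injective f) (hg : Function.Injective g)
    (hrf : ∀ r, r ∈ Set.range f ↔ σ r ∈ Set.range (algebraMap ℂ T))
    (hrg : ∀ s, s ∈ Set.range g ↔ τ s ∈ Set.range (algebraMap ℂ T))
    {Q : Matrix κ κ RC} {a : Matrix κ ι SC} (hQ : Q * Q = Q) (ha : IsInvMor 1 (Q.map ψ) a) :
    ∃ (q : Matrix (ι ⊕ κ) (ι ⊕ κ) RA) (a' : Matrix (ι ⊕ κ) ι SA), q * q = q ∧
      IsInvMor 1 (q.map φ) a' ∧ IsInvMor 1 ((q.map f).map ψ) (a'.map g) ∧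
      MorIso ψ 1 Q a 1 (q.map f) (a'.map g) := by
  classical
  obtain ⟨b, hb, hab, hba⟩ := ha.exists_inv
  have hmap : ∀ {ι κ : Type} (M : Matrix ι κ RC), (M.map ψ).map τ = M.map σ := fun M => by
    ext i j; exact hτ _
  have mm : ∀ {ι κ μ : Type} [Fintype κ] (M : Matrix ι κ SC) (N : Matrix κ μ SC),
    (M * N).map τ = M.map τ * N.map τ := fun M N => Matrix.map_mul
  have hβα : b.map τ * a.map τ = 1 := by
    rw [← mm, hba, Matrix.map_one _ (map_zero τ) (map_one τ)]
  obtain ⟨Q', d, d', hd, hd', hdd', hd'd, hdσ, hd'σ, hQ'σ⟩ := exists_isInvMor_lift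
    (α := a.map τ) (β := b.map τ) (σ : RC →+* T) hσ hQ
    ((congrArg (· * a.map τ) (hmap Q)).symm.trans (by rw [← mm, ha.1.1]))
    ((congrArg (b.map τ * ·) (hmap Q)).symm.trans (by rw [← mm, hb.1.2]))
    (Eq.trans (by rw [← mm, hab]) (hmap Q)) hβα
  have hdinv : IsInvMor Q Q' d := ⟨hd, d', hd', hdd', hd'd⟩
  have hd'inv : IsInvMor Q' Q d' := ⟨hd', d, hd, hd'd, hdd'⟩
  -- The images over `T` of `Q'`, of `d a` and of its inverse `b d'` are scalar.
  obtain ⟨q, rfl⟩ := exists_map_eq_of_isScalar (f := f) (σ := σ) hrf (M := Q')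
    ⟨Matrix.fromBlocks 1 0 0 0, by
      rw [show Q'.map σ = _ from hQ'σ]; simp [Matrix.fromBlocks_map]⟩
  obtain ⟨a', ha'⟩ := exists_map_eq_of_isScalar (f := g) (σ := τ) hrg (M := d.map ψ * a) (by
    rw [mm, hmap, show d.map σ = _ from hdσ, Matrix.fromRows_mul, hβα, Matrix.zero_mul]
    exact isScalar_one.fromRows isScalar_zero)
  obtain ⟨b', hb'⟩ := exists_map_eq_of_isScalar (f := g) (σ := τ) hrg (M := b * d'.map ψ) (by
    rw [mm, hmap, show d'.map σ = _ from hd'σ, Matrix.mul_fromCols, hβα, Matrix.mul_zero]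
    exact isScalar_one.fromCols isScalar_zero)
  have hqψ : (q.map φ).map g = (q.map f).map ψ := by ext i j; exact hfg _
  have oneg : (1 : Matrix ι ι SA).map g = 1 := Matrix.map_one _ (map_zero g) (map_one g)
  have e1 := ha.comp (isInvMor_map (φ := ψ) hdinv)
  have e2 := (isInvMor_map (φ := ψ) hd'inv).comp hb
  refine ⟨q, a', map_injective_matrix hf ?_, ?_, ?_, 1, d, .refl (one_mul _), hdinv, ?_⟩
  · rw [Matrix.map_mul]
    exact hdinv.target_mul_self
  · refine IsInvMor.of_map (f := (g : SA →+* SC)) hg (b := b') ?_ ?_ ?_ ?_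
    · change IsMor ((1 : Matrix ι ι SA).map g) ((q.map φ).map g) (a'.map g)
      rw [oneg, hqψ, ha']
      exact e1.1
    · change IsMor ((q.map φ).map g) ((1 : Matrix ι ι SA).map g) (b'.map g)
      rw [oneg, hqψ, hb']
      exact e2.1
    · change a'.map g * b'.map g = (q.map φ).map g
      rw [ha', hb', hqψ, Matrix.mul_assoc, ← Matrix.mul_assoc a, hab, ← Matrix.map_mul, hd'.1,
        ← Matrix.map_mul, hdd']
    · change b'.map g * a'.map g = (1 : Matrix ι ι SA).map g
      rw [ha', hb', oneg, Matrix.mul_assoc, ← Matrix.mul_assoc (d'.map ψ), ← Matrix.map_mul, hd'd,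
        ha.1.1, hba]
  · rw [ha']
    exact e1
  · rw [ha', Matrix.map_one _ (map_zero ψ) (map_one ψ), Matrix.mul_one]

/-- If an isomorphism `a` over `SA` becomes over `SC` a product `ψ(G) u`, with `G` over `RC` and
`u` in the path component of `1`, then it is such a product over `RA` and `SA`.  Write
`u = ψ(h) v`, with `v` joined to `1` by elements mapping to `1` over `T`; then that path lies over
`SA`, and `G h`, having the same image over `T` as `a`, lies over `RA`. -/
theorem exists_descent_of_eq_mul (hfg : ∀ r, g (φ r) = ψ (f r)) (hτ : ∀ r, τ (ψ r) = σ r)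
    (hσ : Function.Surjective σ) (hf : Function.Injective f) (hg : Function.Injective g)
    (hrf : ∀ r, r ∈ Set.range f ↔ σ r ∈ Set.range (algebraMap ℂ T))
    (hrg : ∀ s, s ∈ Set.range g ↔ τ s ∈ Set.range (algebraMap ℂ T))
    {Q : Matrix κ κ RA} {a : Matrix κ ι SA} (ha : IsInvMor 1 (Q.map φ) a)
    {G : Matrix κ ι RC} {u : Matrix ι ι SC} (hG : IsInvMor 1 (Q.map f) G)
    (hu : JoinedIn {w : Matrix ι ι SC | IsUnit w} 1 u) (hGu : a.map g = G.map ψ * u) :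
    ∃ (G' : Matrix κ ι RA) (u' : Matrix ι ι SA), IsInvMor 1 Q G' ∧
      JoinedIn {w : Matrix ι ι SA | IsUnit w} 1 u' ∧ a = G'.map φ * u' := by
  obtain ⟨h, h', v, hh, hh', huv, hv⟩ := matrix_exists_lift_of_joinedIn ψ σ τ hτ hσ u hu
  have hmap : ∀ {ι κ : Type} (M : Matrix ι κ RC), (M.map ψ).map τ = M.map σ := fun M => by
    ext i j; exact hτ _
  have hfgm : ∀ {ι κ : Type} (M : Matrix ι κ RA), (M.map φ).map g = (M.map f).map ψ := fun M => by
    ext i j; exact hfg _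
  have mm : ∀ {ι κ μ : Type} [Fintype κ] (M : Matrix ι κ SC) (N : Matrix κ μ SC),
    (M * N).map τ = M.map τ * N.map τ := fun M N => Matrix.map_mul
  have onef : (1 : Matrix ι ι RA).map f = 1 := Matrix.map_one _ (map_zero f) (map_one f)
  have oneg : (1 : Matrix ι ι SA).map g = 1 := Matrix.map_one _ (map_zero g) (map_one g)
  have hag : a.map g = (G * h).map ψ * v := by
    rw [hGu, huv, Matrix.map_mul, Matrix.mul_assoc]
  obtain ⟨b, hb, hab, hba⟩ := ha.exists_inv
  have hGh : IsInvMor 1 (Q.map f) (G * h) := (isInvMor_one_iff.2 ⟨⟨h, h', hh, hh'⟩, rfl⟩).comp hG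
  obtain ⟨H, hH, hGH, hHG⟩ := hGh.exists_inv
  have hvτ : v.map τ = 1 := hv.target_mem.1
  have hHψ : H.map ψ = v * b.map g := by
    calc H.map ψ = H.map ψ * (Q.map f).map ψ := by rw [← Matrix.map_mul, hH.1.2]
      _ = H.map ψ * (a.map g * b.map g) := by rw [← hfgm, ← hab, Matrix.map_mul]
      _ = (H.map ψ * (G * h).map ψ) * (v * b.map g) := by
          rw [hag]; simp only [Matrix.mul_assoc]
      _ = v * b.map g := by
          rw [← Matrix.map_mul, hHG, Matrix.map_one _ (map_zero ψ) (map_one ψ), Matrix.one_mul]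
  obtain ⟨G', hG'⟩ := exists_map_eq_of_isScalar (f := f) (σ := σ) hrf (M := G * h) (by
    have : (G * h).map σ = (a.map g).map τ := by
      rw [hag, mm, hvτ, Matrix.mul_one, hmap]
    rw [this]
    exact isScalar_map_map hrg a)
  obtain ⟨H', hH'⟩ := exists_map_eq_of_isScalar (f := f) (σ := σ) hrf (M := H) (by
    have : H.map σ = (b.map g).map τ := by
      rw [← hmap, hHψ, mm, hvτ, Matrix.one_mul]
    rw [this]
    exact isScalar_map_map hrg b)
  have hG'inv : IsInvMor 1 Q G' := by
    refine IsInvMor.of_map (f := (f : RA →+* RC)) hf (b := H') ?_ ?_ ?_ ?_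
    · change IsMor ((1 : Matrix ι ι RA).map f) (Q.map f) (G'.map f)
      rw [onef, hG']
      exact hGh.1
    · change IsMor (Q.map f) ((1 : Matrix ι ι RA).map f) (H'.map f)
      rw [onef, hH']
      exact hH.1
    · change G'.map f * H'.map f = Q.map f
      rw [hG', hH', hGH]
    · change H'.map f * G'.map f = (1 : Matrix ι ι RA).map f
      rw [onef, hG', hH', hHG]
  obtain ⟨γ, hγ⟩ := hv
  have hlift : ∀ t, ∃ w : Matrix ι ι SA, w.map g = γ t ∧ IsUnit w := by
    intro t
    obtain ⟨ht, w', hw', h1, h2⟩ := hγ t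
    obtain ⟨w, hw⟩ := exists_map_eq_of_isScalar (f := g) (σ := τ) hrg (M := γ t)
      (ht ▸ isScalar_one)
    obtain ⟨y, hy⟩ := exists_map_eq_of_isScalar (f := g) (σ := τ) hrg (M := w')
      (hw' ▸ isScalar_one)
    refine ⟨w, hw, ⟨⟨w, y, ?_, ?_⟩, rfl⟩⟩ <;> refine map_injective_matrix hg ?_
    · rw [Matrix.map_mul, hw, hy, h1, oneg]
    · rw [Matrix.map_mul, hw, hy, h2, oneg]
  choose δ hδ hδu using hlift
  -- An injective `⋆`-homomorphism is isometric, so the lifted path is continuous.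
  have hgemb : Topology.IsEmbedding g := (NonUnitalStarAlgHom.isometry g hg).isEmbedding
  have hδc : Continuous δ := by
    refine continuous_matrix fun i j => ?_
    rw [hgemb.continuous_iff]
    have : (g ∘ fun t => δ t i j) = fun t => γ t i j := by
      ext t
      exact congrFun (congrFun (hδ t) i) j
    rw [this]
    exact γ.continuous.matrix_elem i j
  have hδ0 : δ 0 = 1 := map_injective_matrix hg (by rw [hδ, γ.source, oneg])
  refine ⟨G', δ 1, hG'inv, ⟨⟨⟨δ, hδc⟩, hδ0, rfl⟩, hδu⟩, map_injective_matrix hg ?_⟩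
  have hmul : (G'.map φ * δ 1).map g = (G'.map φ).map g * (δ 1).map g := Matrix.map_mul
  rw [hag, hmul, hδ, γ.target, hfgm, hG']

theorem Triple.fromBlocks_compl_mul_self (x : Triple φ ι) :
    Matrix.fromBlocks x.q 0 0 (1 - x.p) * Matrix.fromBlocks x.q 0 0 (1 - x.p) =
      Matrix.fromBlocks x.q 0 0 (1 - x.p) := by
  have h1 := x.hp
  have h2 := x.hq
  simp [Matrix.fromBlocks_multiply, h2, mul_sub, sub_mul, h1]

theorem map_surjective_of_excision (hfg : ∀ r, g (φ r) = ψ (f r)) (hτ : ∀ r, τ (ψ r) = σ r)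
    (hσ : Function.Surjective σ) (hf : Function.Injective f) (hg : Function.Injective g)
    (hrf : ∀ r, r ∈ Set.range f ↔ σ r ∈ Set.range (algebraMap ℂ T))
    (hrg : ∀ s, s ∈ Set.range g ↔ τ s ∈ Set.range (algebraMap ℂ T)) :
    Function.Surjective (K0.map (φ := φ) (ψ := ψ) f g hfg) := by
  intro Y
  induction Y using Quotient.inductionOn with | h Y =>
  obtain ⟨q, a, hqq, ha, hag, hiso⟩ := exists_descent_of_isInvMor hfg hτ hσ hf hg hrf hrg
    Y.2.fromBlocks_compl_mul_self Y.2.isInvMor_one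
  have h1 : (1 : Matrix (Fin Y.1) (Fin Y.1) RA).map φ = 1 :=
    Matrix.map_one _ (map_zero φ) (map_one φ)
  have h1ψ : (1 : Matrix (Fin Y.1) (Fin Y.1) RC).map ψ = 1 :=
    Matrix.map_one _ (map_zero ψ) (map_one ψ)
  obtain ⟨x, hx⟩ := exists_gam_morIso (φ := φ) (p := (1 : Matrix (Fin Y.1) (Fin Y.1) RA))
    (one_mul _) hqq (h1.symm ▸ ha)
  have hx' := hx.map f g hfg
  rw [Matrix.map_one _ (map_zero f) (map_one f)] at hx'
  have hY := Y.addCompl_morIso.trans hiso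
  refine ⟨K0.mk x, (K0.mk_eq_of_iso (y := Y.addCompl) ?_).trans Y.mk_addCompl⟩
  exact hx'.trans (hY.symm Y.addCompl.2.isInvMor_a.1 (h1ψ.symm ▸ hag.1))

theorem map_injective_of_excision (hfg : ∀ r, g (φ r) = ψ (f r)) (hτ : ∀ r, τ (ψ r) = σ r)
    (hσ : Function.Surjective σ) (hf : Function.Injective f) (hg : Function.Injective g)
    (hrf : ∀ r, r ∈ Set.range f ↔ σ r ∈ Set.range (algebraMap ℂ T))
    (hrg : ∀ s, s ∈ Set.range g ↔ τ s ∈ Set.range (algebraMap ℂ T)) :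
    Function.Injective (K0.map (φ := φ) (ψ := ψ) f g hfg) := by
  rw [injective_iff_map_eq_zero]
  intro x hx
  induction x using Quotient.inductionOn with | h x =>
  change K0.mk x = 0
  change K0.map (φ := φ) (ψ := ψ) f g hfg (K0.mk x) = 0 at hx
  rw [← x.mk_addCompl, K0.map_mk] at hx
  have hxm := x.addCompl_morIso
  have ha := x.2.isInvMor_one
  rw [← x.mk_addCompl]
  generalize Matrix.fromBlocks x.2.q 0 0 (1 - x.2.p) = Q at hxm ha
  generalize Matrix.fromRows x.2.a ((1 - x.2.p).map φ) = a at hxm ha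
  have hfgm : (Q.map φ).map g = (Q.map f).map ψ := by
    ext i j; exact hfg _
  have oneg : ∀ {ι : Type} [DecidableEq ι], (1 : Matrix ι ι SA).map g = 1 := fun {ι} _ =>
    Matrix.map_one _ (map_zero g) (map_one g)
  have hxm' := hxm.map f g hfg
  rw [Matrix.map_one _ (map_zero f) (map_one f)] at hxm'
  have haC : IsInvMor 1 ((Q.map f).map ψ) (a.map g) := by
    have := ha.map (g : SA →+* SC)
    change IsInvMor ((1 : Matrix _ _ SA).map g) ((Q.map φ).map g) (a.map g) at this
    rwa [oneg, hfgm] at this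
  obtain ⟨k, G, u, hG, hu, hGu⟩ := exists_of_mk_eq_zero _ hx haC.1 hxm'
  have hA : IsInvMor 1 ((Matrix.fromBlocks Q 0 0 (1 : Matrix (Fin k) (Fin k) RA)).map φ)
      (Matrix.fromBlocks a 0 0 (1 : Matrix (Fin k) (Fin k) SA)) := by
    have := ha.fromBlocks (IsInvMor.refl (one_mul (1 : Matrix (Fin k) (Fin k) SA)))
    rw [Matrix.fromBlocks_one] at this
    simpa [Matrix.fromBlocks_map] using this
  obtain ⟨G', u', hG', hu', hGu'⟩ := exists_descent_of_eq_mul hfg hτ hσ hf hg hrf hrg hA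
    (G := G) (u := u) (by simpa [Matrix.fromBlocks_map] using hG) hu
    (by simpa [Matrix.fromBlocks_map] using hGu)
  exact mk_eq_zero_of_eq_mul _ hxm hG' hu' hGu'

end Excision

/-! ### Exact sequences and unitizations -/

section Unitization

variable {X Y D : Type*} [NonUnitalCStarAlgebra X] [NonUnitalCStarAlgebra Y]
  [NonUnitalCStarAlgebra D]

/-- For a sequence `X → Y → D` exact at `Y`, the image of the unitization of `X` in that of `Y`
consists of the elements with scalar image in the unitization of `D`. -/
theorem mem_range_starMap_iff (θ : X →⋆ₙₐ[ℂ] Y) (η : Y →⋆ₙₐ[ℂ] D) (h : Function.Exact θ η)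
    (r : Unitization ℂ Y) : r ∈ Set.range (Unitization.starMap θ) ↔
      Unitization.starMap η r ∈ Set.range (algebraMap ℂ (Unitization ℂ D)) := by
  constructor
  · rintro ⟨s, rfl⟩
    refine ⟨s.fst, ?_⟩
    ext
    · simp [Unitization.algebraMap_eq_inl]
    · simp [Unitization.algebraMap_eq_inl, h.apply_apply_eq_zero]
  · rintro ⟨z, hz⟩
    have h0 : η r.snd = 0 := by
      have := congrArg (fun u => u.snd) hz
      simpa [Unitization.algebraMap_eq_inl] using this.symm
    obtain ⟨x, hx⟩ := (h _).1 h0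
    refine ⟨Unitization.inl r.fst + Unitization.inr x, ?_⟩
    ext
    · simp [Unitization.algebraMap_eq_inl]
    · simp [Unitization.algebraMap_eq_inl, hx]

end Unitization

end KaroubiRel

theorem theorem2p70
    {A C D : Type*} [NonUnitalCStarAlgebra A] [NonUnitalCStarAlgebra C] [NonUnitalCStarAlgebra D]
    (A' : NonUnitalStarSubalgebra ℂ A) (hA' : IsClosed (A' : Set A))
    (C' : NonUnitalStarSubalgebra ℂ C) (hC' : IsClosed (C' : Set C))
    (π : A →⋆ₙₐ[ℂ] C) (ρ : C →⋆ₙₐ[ℂ] D)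
    (hπ_inj : Function.Injective π) (hexact : Function.Exact π ρ)
    (hρ_surj : Function.Surjective ρ)
    (hπ : ∀ a ∈ A', π a ∈ C')
    (hπ_inj' : Function.Injective (KaroubiRel.restrict π hπ))
    (hexact' : Function.Exact (KaroubiRel.restrict π hπ) (fun c : C' => ρ c))
    (hρ_surj' : Function.Surjective (fun c : C' => ρ c)) :
    Function.Bijective (KaroubiRel.RelK0.map π hπ) := by
  have := hA'
  have := hC'
  let ρ' : C' →⋆ₙₐ[ℂ] D := ρ.comp (NonUnitalStarSubalgebraClass.subtype C')
  have hτ : ∀ r, Unitization.starMap ρ (KaroubiRel.unitalInclusion C' r) =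
      Unitization.starMap ρ' r := fun r => by
    have e : (Unitization.starMap ρ).comp (KaroubiRel.unitalInclusion C') =
        Unitization.starMap ρ' := by
      rw [KaroubiRel.unitalInclusion, ← Unitization.starMap_comp]
    exact DFunLike.congr_fun e r
  have hσ : Function.Surjective (Unitization.starMap ρ') :=
    Unitization.starMap_surjective hρ_surj'
  have hf := Unitization.starMap_injective hπ_inj'
  have hg := Unitization.starMap_injective hπ_inj
  have hrf := KaroubiRel.mem_range_starMap_iff (KaroubiRel.restrict π hπ) ρ' hexact'
  have hrg := KaroubiRel.mem_range_starMap_iff π ρ hexact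
  exact ⟨KaroubiRel.map_injective_of_excision _ hτ hσ hf hg hrf hrg,
    KaroubiRel.map_surjective_of_excision _ hτ hσ hf hg hrf hrg⟩
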